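/- Let $d\ge 1$ and $\delta\in(0,1)$. There is a constant $N=N(d,\delta)>0$ such that the following holds. Let $T\in(-\infty,\infty]$, $\mathbb R_T=(-\infty,T)$, let $1\le k\le d$ be an integer, and put $\Xi^k=\{x\in\mathbb R^d: x_1>0,\dots,x_k>0\}$, with faces $\Gamma^{k,i}=\partial\Xi^k\cap\{x_i=0\}$, $1\le i\le k$. Let $a^{ij}$ ($1\le i,j\le d$) be real measurable functions on $\mathbb R^2$, not necessarily symmetric in $(i,j)$, used as coefficients $a^{ij}=a^{ij}(t,x_d)$, such that $$\delta|\xi|^2\le\sum_{i,j=1}^d a^{ij}\xi_i\xi_j\quad\text{for all }\xi\in\mathbb R^d,\qquad |a^{ij}|\le\delta^{-1},$$ and such that $a^{dd}$ is a measurable function of $t$ only or a measurable function of $x_d$ only. Let $W^{1,2}_2(\mathbb R_T\times\Xi^k)$ be the space of $u\in L_2(\mathbb R_T\times\Xi^k)$ whose weak derivatives $Du$, $D^2u$, $u_t$ belong to $L_2(\mathbb R_T\times\Xi^k)$. Fix one of the following two sets of boundary conditions, understood in the sense of traces: either $u=0$ on $\mathbb R_T\times\Gamma^{k,1}$ (Dirichlet)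 or $D_1u=0$ on $\mathbb R_T\times\Gamma^{k,1}$ (Neumann); and in both cases $u=0$ on $\mathbb R_T\times\Gamma^{k,i}$ for $2\le i\le k$. (i) If $\lambda\ge0$, $f\in L_2(\mathbb R_T\times\Xi^k)$, and $u\in W^{1,2}_2(\mathbb R_T\times\Xi^k)$ satisfies these boundary conditions and $$-u_t+\sum_{i,j=1}^d a^{ij}(t,x_d)D_{ij}u-\lambda u=f\quad\text{a.e. in }\mathbb R_T\times\Xi^k,$$ then, with all norms taken in $L_2(\mathbb R_T\times\Xi^k)$, $$\lambda\|u\|+\lambda^{1/2}\|Du\|+\|D^2u\|+\|u_t\|\le N\|f\|.$$ (ii) For every $\lambda>0$ and every $f\in L_2(\mathbb R_T\times\Xi^k)$ there is a unique $u\in W^{1,2}_2(\mathbb R_T\times\Xi^k)$ satisfying this equation and these boundary conditions. -/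

import Mathlib

open MeasureTheory

open scoped ContDiff

noncomputable section

namespace ParabolicWedge

/-- Space-time `ℝ × ℝ^d` with `d = n + 1`, so that `d ≥ 1`. A point is `(t, x)`; the coordinates
`x_1, …, x_d` are `x 0, …, x (Fin.last n)`. Only coordinates, the topology and Lebesgue measure
of `ℝ^d` are used. -/
abbrev SpaceTime (n : ℕ) : Type := ℝ × (Fin (n + 1) → ℝ)

/-- The cylinder `ℝ_T × Ξ^k`, where `ℝ_T = (-∞, T)`, `T ∈ (-∞, ∞]`, and
`Ξ^k = {x : x_1 > 0, …, x_k > 0}`. -/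
def wedgeCylinder (n : ℕ) (T : WithTop ℝ) (k : ℕ) : Set (SpaceTime n) :=
  {z | (z.1 : WithTop ℝ) < T ∧ ∀ i : Fin (n + 1), i.val < k → 0 < z.2 i}

/-- The lateral face `ℝ_T × {x ∈ ∂Ξ^k : x_i = 0}`, up to a null set (the edges), in the
coordinates `(t, y)`, `y ∈ ℝ^(d-1)`, obtained by dropping `x_i = 0`. -/
def lateralFace (n : ℕ) (T : WithTop ℝ) (k : ℕ) (i : Fin (n + 1)) : Set (ℝ × (Fin n → ℝ)) :=
  {y | (y.1 : WithTop ℝ) < T ∧ ∀ j : Fin n, (i.succAbove j).val < k → 0 < y.2 j}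

/-- The real Hilbert space `L_2(S)` with respect to Lebesgue measure. -/
abbrev L2 {α : Type*} [MeasureSpace α] (S : Set α) : Type _ :=
  Lp ℝ 2 (volume.restrict S)

/-- Real-valued `C^∞` functions on space-time with compact support contained in `S`. -/
structure IsTestFunction {n : ℕ} (S : Set (SpaceTime n)) (φ : SpaceTime n → ℝ) : Prop where
  smooth : ContDiff ℝ ∞ φ
  compact : HasCompactSupport φ
  support_subset : tsupport φ ⊆ S

/-- The unit vector of the time direction. -/
def timeDir (n : ℕ) : SpaceTime n := (1, 0)

/-- The unit vector of the `i`-th spatial direction. -/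
def spaceDir {n : ℕ} (i : Fin (n + 1)) : SpaceTime n := (0, Pi.single i 1)

/-- `h` is the weak derivative of `g` in the direction `v` in the set `S` (used for open `S`). -/
def IsWeakDeriv {n : ℕ} {S : Set (SpaceTime n)} (v : SpaceTime n) (g h : L2 S) : Prop :=
  ∀ φ : SpaceTime n → ℝ, IsTestFunction S φ →
    ∫ z in S, g z * fderiv ℝ φ z v = -∫ z in S, h z * φ z

/-- The space `W_2^{1,2}(ℝ_T × Ξ^k)`: functions `u` in `L_2` whose weak derivatives
`Du`, `D²u`, `u_t` exist and are in `L_2`. The weak derivatives, which are determined by `u`,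
are recorded as part of the element. -/
structure W12 (n : ℕ) (T : WithTop ℝ) (k : ℕ) where
  /-- the function `u` -/
  val : L2 (wedgeCylinder n T k)
  /-- `D_i u` -/
  grad : Fin (n + 1) → L2 (wedgeCylinder n T k)
  /-- `D_{ij} u` -/
  hess : Fin (n + 1) → Fin (n + 1) → L2 (wedgeCylinder n T k)
  /-- `u_t` -/
  dt : L2 (wedgeCylinder n T k)
  grad_weak : ∀ i, IsWeakDeriv (spaceDir i) val (grad i)
  hess_weak : ∀ i j, IsWeakDeriv (spaceDir j) (grad i) (hess i j)
  dt_weak : IsWeakDeriv (timeDir n) val dt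

/-- `τ` is the trace on the lateral face `{x_i = 0}` of a function `g` with weak derivative
`h = D_i g`: Green's formula
`∫ (g D_i φ + h φ) dx dt = -∫_{x_i = 0} τ φ`
holds for all smooth `φ` whose compact support is allowed to meet this face, but no other face. -/
def IsTrace {n : ℕ} {T : WithTop ℝ} {k : ℕ} (i : Fin (n + 1))
    (g h : L2 (wedgeCylinder n T k)) (τ : L2 (lateralFace n T k i)) : Prop :=
  ∀ φ : SpaceTime n → ℝ,
    IsTestFunction
      {z | (z.1 : WithTop ℝ) < T ∧ ∀ j : Fin (n + 1), j.val < k → j ≠ i → 0 < z.2 j} φ →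
    ∫ z in wedgeCylinder n T k, (g z * fderiv ℝ φ z (spaceDir i) + h z * φ z) =
      -∫ y in lateralFace n T k i, τ y * φ (y.1, i.insertNth 0 y.2)

/-- The two kinds of boundary condition. -/
inductive BoundaryKind : Type
  | dirichlet
  | neumann

namespace W12

variable {n : ℕ} {T : WithTop ℝ} {k : ℕ}

/-- The Dirichlet condition `u = 0` on the face `{x_i = 0}`, in the sense of traces. -/
def DirichletOn (u : W12 n T k) (i : Fin (n + 1)) : Prop :=
  IsTrace i u.val (u.grad i) 0

/-- The Neumann condition `D_i u = 0` on the face `{x_i = 0}`, in the sense of traces. -/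
def NeumannOn (u : W12 n T k) (i : Fin (n + 1)) : Prop :=
  IsTrace i (u.grad i) (u.hess i i) 0

/-- The condition of the kind `b` on the first face `{x_1 = 0}`, and the Dirichlet condition on
the other faces `{x_i = 0}`, `2 ≤ i ≤ k`. -/
def BoundaryCondition (b : BoundaryKind) (u : W12 n T k) : Prop :=
  (match b with
    | .dirichlet => u.DirichletOn 0
    | .neumann => u.NeumannOn 0) ∧
  ∀ i : Fin (n + 1), i ≠ 0 → i.val < k → u.DirichletOn i

/-- The equation `-u_t + a^{ij} D_{ij} u - λ u = f` almost everywhere in `ℝ_T × Ξ^k`, for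
coefficients `a^{ij} = a^{ij}(t, x_d)`. -/
def Solves (u : W12 n T k) (a : Fin (n + 1) → Fin (n + 1) → ℝ → ℝ → ℝ) (lam : ℝ)
    (f : L2 (wedgeCylinder n T k)) : Prop :=
  ∀ᵐ z ∂(volume.restrict (wedgeCylinder n T k)),
    -(u.dt z) + ∑ i, ∑ j, a i j z.1 (z.2 (Fin.last n)) * u.hess i j z - lam * u.val z = f z

/-- `‖Du‖_{L_2}`, that is, the `L_2` norm of the Euclidean length of `Du`. -/
def gradNorm (u : W12 n T k) : ℝ := √(∑ i, ‖u.grad i‖ ^ 2)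

/-- `‖D²u‖_{L_2}`, that is, the `L_2` norm of the Euclidean length of `D²u`. -/
def hessNorm (u : W12 n T k) : ℝ := √(∑ i, ∑ j, ‖u.hess i j‖ ^ 2)

end W12

/-- The conditions on the coefficients `a^{ij}(t, x_d)`, written `a i j t s`: measurability,
uniform nondegeneracy and boundedness with the constant `δ`, and `a^{dd}` is a function of `t`
only or a function of `x_d` only. The matrix need not be symmetric. -/
structure AdmissibleCoeff {n : ℕ} (δ : ℝ)
    (a : Fin (n + 1) → Fin (n + 1) → ℝ → ℝ → ℝ) : Prop where
  meas : ∀ i j, AEMeasurable (fun p : ℝ × ℝ => a i j p.1 p.2) volume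
  elliptic : ∀ (t s : ℝ) (ξ : Fin (n + 1) → ℝ),
    δ * ∑ i, ξ i ^ 2 ≤ ∑ i, ∑ j, a i j t s * ξ i * ξ j
  bounded : ∀ i j t s, |a i j t s| ≤ δ⁻¹
  last :
    (∃ α : ℝ → ℝ, AEMeasurable α volume ∧
      ∀ t s, a (Fin.last n) (Fin.last n) t s = α t) ∨
    (∃ α : ℝ → ℝ, AEMeasurable α volume ∧
      ∀ t s, a (Fin.last n) (Fin.last n) t s = α s)

end ParabolicWedge

end

set_option linter.unusedSectionVars false

/-! Everything is expressed through translations in the Hilbert space L2 of the cylinder. If a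
direction `v` maps the cylinder into itself, then `V s g = g(· + s v)` and its adjoint `W s`, the
translation by `-s v` after extension by zero, are strongly continuous semigroups of contractions.
The generator of `V` is the weak derivative along `v` without boundary condition; the generator of
`W` is minus that derivative, restricted to functions with zero trace on the face that `v` points
away from. Hence weak derivatives, Dirichlet and Neumann conditions are all statements `Gen`, and
integration by parts is adjointness of generators (`gen_iff`, `isWeakDeriv_iff`,
`isTrace_zero_iff`). Where third derivatives would appear, one of them is replaced by a difference
quotient.

A priori estimate. Multiply the equation by `q(x_d)^2`, equal to 1 if a^{dd} depends on t and to
1/a^{dd} if it depends on x_d; the new a^{dd} is independent of x_d. Test with D_kk u, k < d. The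
coefficients do not depend on x_k, so integrating by parts in x_k and x_j turns D_ij u D_kk u into
D_ik u D_jk u (exchange i and j if only j is d; if both are d, the new a^{dd} passes through).
Ellipticity then bounds D D_k u, since u_t and λu contribute with a favourable sign. Integration in
x_j uses u = 0 on {x_j = 0}, which may fail for j = 1. Therefore k = 1 is treated first, and then
all terms with an index 1 are moved to the right-hand side (`InSpace.norm_mixed_le`). What remains
is an equation in D_dd u, u_t and u alone, tested with D_dd u in one case and with u_t and u in the
other (`InSpace.norm_last_le`).

Solvability. For the heat operator the estimate makes the range closed. An element `x` orthogonal to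
the range is smoothed by a product `P` of one-dimensional resolvents that respects the boundary
conditions; `P x` solves the backward heat equation with zero final data, so the energy identity and
injectivity of `P` give `x = 0` (`eq_zero_of_orthogonal_heat`). The segment from the Laplacian to
a^{ij} stays in the same class of coefficients, so the method of continuity applies. -/

namespace ParabolicWedge

open Filter Topology
open scoped RealInnerProductSpace

/-! ### Adjoint pairs of semigroups and their generators -/

section AbstractShifts

variable {H : Type*} [NormedAddCommGroup H] [InnerProductSpace ℝ H] [CompleteSpace H]

/-- `q` is the image of `p` under the generator of the semigroup `V`, in integrated form. -/
def Gen (V : ℝ → H →L[ℝ] H) (p q : H) : Prop :=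
  ∀ s : ℝ, 0 ≤ s → V s p - p = ∫ r in (0 : ℝ)..s, V r q

/-- Two strongly continuous semigroups which are adjoint to each other. -/
structure ShiftPair (V W : ℝ → H →L[ℝ] H) : Prop where
  adj : ∀ s x y, ⟪V s x, y⟫ = ⟪x, W s y⟫
  cont_left : ∀ x, Continuous fun s => V s x
  cont_right : ∀ x, Continuous fun s => W s x
  zero_left : ∀ x, V 0 x = x
  zero_right : ∀ x, W 0 x = x
  add_left : ∀ s r x, 0 ≤ s → 0 ≤ r → V s (V r x) = V (s + r) x
  add_right : ∀ s r x, 0 ≤ s → 0 ≤ r → W s (W r x) = W (s + r) x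

variable {V W P Q : ℝ → H →L[ℝ] H}

theorem ShiftPair.symm (h : ShiftPair V W) : ShiftPair W V where
  adj s x y := by rw [real_inner_comm, ← h.adj, real_inner_comm]
  cont_left := h.cont_right
  cont_right := h.cont_left
  zero_left := h.zero_right
  zero_right := h.zero_left
  add_left := h.add_right
  add_right := h.add_left

theorem ShiftPair.intervalIntegrable (h : ShiftPair V W) (x : H) (a b : ℝ) :
    IntervalIntegrable (fun s => V s x) volume a b :=
  (h.cont_left x).intervalIntegrable a b

theorem Gen.zero : Gen V 0 0 := fun s _ => by simp

theorem Gen.add (h : ShiftPair V W) {p q p' q' : H} (h₁ : Gen V p q) (h₂ : Gen V p' q') :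
    Gen V (p + p') (q + q') := fun s hs => by
  simp only [map_add]
  rw [intervalIntegral.integral_add (h.intervalIntegrable _ _ _) (h.intervalIntegrable _ _ _),
    ← h₁ s hs, ← h₂ s hs]
  abel

theorem Gen.smul {p q : H} (c : ℝ) (h₁ : Gen V p q) : Gen V (c • p) (c • q) := fun s hs => by
  simp only [map_smul]
  rw [intervalIntegral.integral_smul, ← h₁ s hs, smul_sub]

theorem Gen.neg {p q : H} (h₁ : Gen V p q) : Gen V (-p) (-q) := by
  simpa using h₁.smul (-1)

theorem Gen.sub (h : ShiftPair V W) {p q p' q' : H} (h₁ : Gen V p q) (h₂ : Gen V p' q') :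
    Gen V (p - p') (q - q') := by
  simpa [sub_eq_add_neg] using h₁.add h h₂.neg

theorem Gen.map {p q : H} (h : ShiftPair V W) (B : H →L[ℝ] H)
    (hB : ∀ s x, B (V s x) = V s (B x)) (h₁ : Gen V p q) : Gen V (B p) (B q) := fun s hs => by
  simp only [← hB]
  rw [B.intervalIntegral_comp_comm (h.intervalIntegrable _ _ _), ← h₁ s hs, map_sub]

theorem tendsto_average (h : ShiftPair V W) (q : H) :
    Tendsto (fun s : ℝ => s⁻¹ • ∫ r in (0 : ℝ)..s, V r q) (𝓝[>] 0) (𝓝 q) := by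
  have h₁ : HasDerivAt (fun s : ℝ => ∫ r in (0 : ℝ)..s, V r q) (V 0 q) 0 :=
    intervalIntegral.integral_hasDerivAt_right (h.intervalIntegrable _ _ _)
      ((h.cont_left q).stronglyMeasurableAtFilter _ _) (h.cont_left q).continuousAt
  have h₂ := h₁.tendsto_slope_zero_right
  simpa [h.zero_left] using h₂

theorem Gen.tendsto {p q : H} (h : ShiftPair V W) (h₁ : Gen V p q) :
    Tendsto (fun s : ℝ => s⁻¹ • (V s p - p)) (𝓝[>] 0) (𝓝 q) := by
  refine (tendsto_average h q).congr' ?_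
  filter_upwards [self_mem_nhdsWithin] with s hs
  rw [h₁ s (le_of_lt hs)]

theorem Gen.tendsto_inner {p q : H} (h : ShiftPair V W) (h₁ : Gen V p q) (β : H) :
    Tendsto (fun s : ℝ => s⁻¹ * ⟪β, V s p - p⟫) (𝓝[>] 0) (𝓝 ⟪β, q⟫) := by
  have := (tendsto_const_nhds (x := β)).inner (𝕜 := ℝ) (h₁.tendsto h)
  simpa [real_inner_smul_right] using this

/-- Both pairings are limits of one and the same difference quotient, moved across the inner product
by adjointness of the semigroups. This is the integration by parts used throughout. -/
theorem Gen.adjoint {p q g k : H} (h : ShiftPair V W) (h₁ : Gen V p q) (h₂ : Gen W g k) :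
    ⟪g, q⟫ = ⟪k, p⟫ := by
  have a₁ := h₁.tendsto_inner h g
  have a₂ := h₂.tendsto_inner h.symm p
  rw [real_inner_comm] at a₂
  refine tendsto_nhds_unique a₁ (a₂.congr fun s => ?_)
  congr 1
  rw [inner_sub_right, inner_sub_right, ← h.adj, real_inner_comm, real_inner_comm p]

theorem ShiftPair.inner_integral (h : ShiftPair V W) (x y : H) (s : ℝ) :
    ⟪∫ r in (0 : ℝ)..s, V r x, y⟫ = ∫ r in (0 : ℝ)..s, ⟪V r x, y⟫ := by
  have := (innerSL ℝ y).intervalIntegral_comp_comm (h.intervalIntegrable x 0 s)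
  simp only [innerSL_apply_apply] at this
  rw [real_inner_comm, ← this]
  simp only [real_inner_comm]

theorem ShiftPair.inner_integral_comm (h : ShiftPair V W) (x y : H) (s : ℝ) :
    ⟪∫ r in (0 : ℝ)..s, V r x, y⟫ = ⟪x, ∫ r in (0 : ℝ)..s, W r y⟫ := by
  rw [h.inner_integral, real_inner_comm, h.symm.inner_integral]
  simp only [h.adj, real_inner_comm]

/-- Averages along the semigroup lie in the domain of the generator. They serve as test elements and
show that the domain is dense. -/
theorem ShiftPair.gen_integral (h : ShiftPair V W) (β : H) {s : ℝ} (hs : 0 ≤ s) :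
    Gen V (∫ r in (0 : ℝ)..s, V r β) (V s β - β) := by
  intro t ht
  rw [← (V t).intervalIntegral_comp_comm (h.intervalIntegrable _ _ _)]
  have h₁ : ∫ r in (0 : ℝ)..s, V t (V r β) = ∫ r in (t)..(t + s), V r β := by
    rw [intervalIntegral.integral_congr (g := fun r => V (t + r) β)]
    · simpa using intervalIntegral.integral_comp_add_left (a := 0) (b := s)
        (fun r => V r β) t
    · intro r hr
      rw [Set.uIcc_of_le hs] at hr
      exact h.add_left _ _ _ ht hr.1
  have h₂ : ∫ r in (0 : ℝ)..t, V r (V s β - β)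
      = (∫ r in (s)..(s + t), V r β) - ∫ r in (0 : ℝ)..t, V r β := by
    simp only [map_sub]
    rw [intervalIntegral.integral_sub (h.intervalIntegrable _ _ _) (h.intervalIntegrable _ _ _)]
    congr 1
    rw [intervalIntegral.integral_congr (g := fun r => V (s + r) β)]
    · simpa using intervalIntegral.integral_comp_add_left (a := 0) (b := t)
        (fun r => V r β) s
    · intro r hr
      rw [Set.uIcc_of_le ht] at hr
      simp only
      rw [h.add_left _ _ _ hr.1 hs, add_comm]
  rw [h₁, h₂, add_comm t s]
  have e₁ := intervalIntegral.integral_add_adjacent_intervals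
    (h.intervalIntegrable β 0 t) (h.intervalIntegrable β t (s + t))
  have e₂ := intervalIntegral.integral_add_adjacent_intervals
    (h.intervalIntegrable β 0 s) (h.intervalIntegrable β s (s + t))
  rw [← e₂] at e₁
  rw [sub_eq_sub_iff_add_eq_add, add_comm, e₁, add_comm]

/-- Testing with the averages of `W` already recovers the integrated identity that defines `Gen`, so
the generator of `V` is the full adjoint of the generator of `W`. -/
theorem Gen.of_adjoint {p q : H} (h : ShiftPair V W)
    (h₁ : ∀ g k, Gen W g k → ⟪g, q⟫ = ⟪k, p⟫) : Gen V p q := by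
  intro s hs
  refine ext_inner_left ℝ fun β => ?_
  have h₂ := h₁ _ _ (h.symm.gen_integral β hs)
  rw [h.symm.inner_integral_comm] at h₂
  rw [h₂, inner_sub_left, inner_sub_right, h.symm.adj]

theorem gen_iff {p q : H} (h : ShiftPair V W) :
    Gen V p q ↔ ∀ g k, Gen W g k → ⟪g, q⟫ = ⟪k, p⟫ :=
  ⟨fun h₁ _ _ h₂ => h₁.adjoint h h₂, Gen.of_adjoint h⟩

theorem ShiftPair.eq_zero_of_inner (h : ShiftPair V W) {x : H}
    (hx : ∀ g k, Gen V g k → ⟪g, x⟫ = 0) : x = 0 := by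
  have h₁ := (tendsto_average h x).inner (𝕜 := ℝ) (tendsto_const_nhds (x := x))
  have h₂ : Tendsto (fun s : ℝ => ⟪s⁻¹ • ∫ r in (0 : ℝ)..s, V r x, x⟫) (𝓝[>] 0) (𝓝 0) := by
    refine tendsto_const_nhds.congr' ?_
    filter_upwards [self_mem_nhdsWithin] with s hs
    rw [real_inner_smul_left, hx _ _ (h.gen_integral x (le_of_lt hs)), mul_zero]
  exact inner_self_eq_zero.1 (tendsto_nhds_unique h₁ h₂)

theorem Gen.unique {p q q' : H} (h : ShiftPair V W) (h₁ : Gen V p q) (h₂ : Gen V p q') :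
    q = q' :=
  tendsto_nhds_unique (h₁.tendsto h) (h₂.tendsto h)

theorem isClosed_gen (h : ShiftPair V W) : IsClosed {x : H × H | Gen V x.1 x.2} := by
  have : {x : H × H | Gen V x.1 x.2}
      = ⋂ g, ⋂ k, ⋂ (_ : Gen W g k), {x : H × H | ⟪g, x.2⟫ = ⟪k, x.1⟫} := by
    ext x
    simp [gen_iff h]
  rw [this]
  refine isClosed_iInter fun g => isClosed_iInter fun k => isClosed_iInter fun _ => ?_
  exact isClosed_eq (by fun_prop) (by fun_prop)

/-- Generators of commuting semigroups can be interchanged. -/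
theorem Gen.mixed {u uk ui uki : H} (h : ShiftPair V W) (h' : ShiftPair P Q)
    (hc : ∀ s r x, V s (P r x) = P r (V s x))
    (h₁ : Gen V u uk) (h₂ : Gen P u ui) (h₃ : Gen P uk uki) : Gen V ui uki := by
  intro s hs
  rw [← sub_eq_zero]
  -- Test against the dense domain of the generator of `Q`: the derivative along `P` is moved to the
  -- test element, where only the known identity for `u` is needed, and then back onto `V r uk`.
  refine h'.symm.eq_zero_of_inner fun g k hg => ?_
  have e₁ := ((h₂.map h' (V s) (hc s)).sub h' h₂).adjoint h' hg
  rw [inner_sub_right, e₁, h₁ s hs, real_inner_comm _ k, h.inner_integral, real_inner_comm _ g,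
    h.inner_integral, sub_eq_zero]
  refine intervalIntegral.integral_congr fun r _ => ?_
  rw [real_inner_comm, real_inner_comm g]
  exact ((h₃.map h' (V r) (hc r)).adjoint h' hg).symm

/-- If `W r` is a right inverse of `V r`, then the generator of `V` extends that of `-W`. -/
theorem Gen.neg_of_cancel {g k : H} (h : ShiftPair V W)
    (hVW : ∀ s r x, 0 ≤ r → r ≤ s → V s (W r x) = V (s - r) x) (h₁ : Gen W g (-k)) :
    Gen V g k := by
  intro s hs
  -- Applying `V s` to the identity for `W s` undoes the translation, and `r ↦ s - r` turns the
  -- integral into the one wanted for `V`.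
  have e := congrArg (V s) (h₁ s hs)
  rw [← (V s).intervalIntegral_comp_comm (h.symm.intervalIntegrable _ _ _), map_sub,
    hVW s s g hs le_rfl, sub_self, h.zero_left,
    intervalIntegral.integral_congr (g := fun r => -V (s - r) k)] at e
  · rw [intervalIntegral.integral_neg,
      intervalIntegral.integral_comp_sub_left (fun r => V r k) s, sub_self, sub_zero] at e
    rw [← neg_sub, e, neg_neg]
  · intro r hr
    rw [Set.uIcc_of_le hs] at hr
    simp only
    rw [hVW s r _ hr.1 hr.2, map_neg]

/-- The graph of the generator. -/
def genGraph (h : ShiftPair V W) : Submodule ℝ (WithLp 2 (H × H)) where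
  carrier := {x | Gen V x.fst x.snd}
  zero_mem' := Gen.zero
  add_mem' h₁ h₂ := Gen.add h h₁ h₂
  smul_mem' c _ h₁ := Gen.smul c h₁

theorem isClosed_genGraph (h : ShiftPair V W) :
    IsClosed (genGraph h : Set (WithLp 2 (H × H))) :=
  (isClosed_gen h).preimage (WithLp.prod_continuous_ofLp 2 H H)

/-- With `v = A u` and `A* v = -u`, adjointness gives `‖v‖² = -‖u‖²`. -/
theorem Gen.eq_zero_of_resolvent {u v : H} (h : ShiftPair V W) (h₁ : Gen V u v)
    (h₂ : Gen W v (0 - u)) : u = 0 ∧ v = 0 := by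
  have e := h₁.adjoint h h₂
  rw [zero_sub, inner_neg_left] at e
  have e₁ := real_inner_self_nonneg (x := u)
  have e₂ := real_inner_self_nonneg (x := v)
  exact ⟨inner_self_eq_zero.1 (le_antisymm (by linarith) e₁),
    inner_self_eq_zero.1 (le_antisymm (by linarith) e₂)⟩

/-- The resolvent `(1 + A*A)⁻¹`, where `A` is the generator of `V`, together with `A (1 + A*A)⁻¹`. -/
theorem exists_resolvent (h : ShiftPair V W) :
    ∃ J K : H →L[ℝ] H, ∀ f, Gen V (J f) (K f) ∧ Gen W (K f) (f - J f) := by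
  have : CompleteSpace (genGraph h) := (isClosed_genGraph h).completeSpace_coe
  let pr := (genGraph h).starProjection
  let inl : H →L[ℝ] WithLp 2 (H × H) :=
    (WithLp.prodContinuousLinearEquiv 2 ℝ H H).symm.toContinuousLinearMap ∘L
      ContinuousLinearMap.inl ℝ H H
  let out : WithLp 2 (H × H) →L[ℝ] H × H :=
    (WithLp.prodContinuousLinearEquiv 2 ℝ H H).toContinuousLinearMap
  refine ⟨ContinuousLinearMap.fst ℝ H H ∘L out ∘L pr ∘L inl,
    ContinuousLinearMap.snd ℝ H H ∘L out ∘L pr ∘L inl, fun f => ⟨?_, ?_⟩⟩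
  · exact Submodule.starProjection_apply_mem (genGraph h) (inl f)
  · refine Gen.of_adjoint h.symm fun g k hg => ?_
    -- `(J f, K f)` is the orthogonal projection of `(f, 0)` onto the graph of `A`. That the
    -- remainder `(f - J f, -K f)` is orthogonal to the graph says exactly `A* K f = f - J f`.
    have e := Submodule.sub_starProjection_mem_orthogonal (K := genGraph h) (inl f)
    have e' := (Submodule.mem_orthogonal _ _).1 e (WithLp.toLp 2 (g, k)) hg
    rw [WithLp.prod_inner_apply] at e'
    have e₁ : ⟪g, f - (pr (inl f)).fst⟫ + ⟪k, 0 - (pr (inl f)).snd⟫ = 0 := e'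
    rw [zero_sub, inner_neg_right, add_neg_eq_zero] at e₁
    exact e₁

end AbstractShifts

/-! ### Translations and multiplications on L2 -/

instance isAddHaarMeasure_spaceTime (n : ℕ) :
    (volume : Measure (SpaceTime n)).IsAddHaarMeasure :=
  inferInstanceAs (Measure.IsAddHaarMeasure
    ((volume : Measure ℝ).prod (volume : Measure (Fin (n + 1) → ℝ))))

section ShiftOperators

variable {n : ℕ} {S : Set (SpaceTime n)}

theorem inner_L2 {α : Type*} [MeasureSpace α] {S : Set α} (f g : L2 S) :
    ⟪f, g⟫ = ∫ z in S, f z * g z := by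
  rw [L2.inner_def]
  refine integral_congr_ae (ae_of_all _ fun z => ?_)
  simp [mul_comm]

/-- Restriction of functions to `S`. -/
noncomputable def restrictL2 (S : Set (SpaceTime n)) :
    Lp ℝ 2 (volume : Measure (SpaceTime n)) →L[ℝ] L2 S :=
  LpToLpRestrictCLM (SpaceTime n) ℝ ℝ volume 2 S

/-- Extension of functions on `S` by zero. -/
noncomputable def extendL2 (S : Set (SpaceTime n)) :
    L2 S →L[ℝ] Lp ℝ 2 (volume : Measure (SpaceTime n)) :=
  (restrictL2 S).adjoint

theorem restrictL2_coe (g : Lp ℝ 2 (volume : Measure (SpaceTime n))) :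
    restrictL2 S g =ᵐ[volume.restrict S] g :=
  LpToLpRestrictCLM_coeFn ℝ S g

theorem extendL2_coe (hS : MeasurableSet S) (g : L2 S) : extendL2 S g =ᵐ[volume] S.indicator g := by
  have hm : MemLp (S.indicator g) 2 volume :=
    (memLp_indicator_iff_restrict hS).2 (Lp.memLp g)
  have : extendL2 S g = hm.toLp := by
    refine ext_inner_right ℝ fun x => ?_
    rw [extendL2, ContinuousLinearMap.adjoint_inner_left, inner_L2, L2.inner_def,
      ← integral_indicator hS]
    refine integral_congr_ae ?_
    filter_upwards [hm.coeFn_toLp, (ae_restrict_iff' hS).1 (restrictL2_coe (S := S) x)]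
      with z h₁ h₂
    rw [h₁]
    by_cases hz : z ∈ S
    · simp [hz, h₂ hz, mul_comm]
    · simp [hz]
  rw [this]
  exact hm.coeFn_toLp

/-- Translation of functions on the whole space. -/
noncomputable def translateL2 (v : SpaceTime n) :
    Lp ℝ 2 (volume : Measure (SpaceTime n)) →L[ℝ] Lp ℝ 2 (volume : Measure (SpaceTime n)) :=
  (Lp.compMeasurePreservingₗᵢ ℝ (· + v)
    (measurePreserving_add_right volume v)).toContinuousLinearMap

theorem translateL2_coe (v : SpaceTime n) (g : Lp ℝ 2 (volume : Measure (SpaceTime n))) :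
    translateL2 v g =ᵐ[volume] fun z => g (z + v) :=
  Lp.coeFn_compMeasurePreserving g (measurePreserving_add_right volume v)

theorem continuous_translateL2 (g : Lp ℝ 2 (volume : Measure (SpaceTime n))) :
    Continuous fun v => translateL2 v g := by
  let c : SpaceTime n → C(SpaceTime n, SpaceTime n) := fun v => ⟨(· + v), by fun_prop⟩
  have hc : Continuous c :=
    ContinuousMap.continuous_of_continuous_uncurry _ (by
      simp only [c, Function.uncurry_def, ContinuousMap.coe_mk]; fun_prop)
  exact (continuous_const (y := g)).compMeasurePreservingLp hc
    (fun v => measurePreserving_add_right volume v) (by simp)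

/-- The function `z ↦ g (z + v)` on `S`, where `g` is extended by zero outside of `S`. -/
noncomputable def shift (S : Set (SpaceTime n)) (v : SpaceTime n) : L2 S →L[ℝ] L2 S :=
  restrictL2 S ∘L translateL2 v ∘L extendL2 S

theorem shift_coe (hS : MeasurableSet S) (v : SpaceTime n) (g : L2 S) :
    shift S v g =ᵐ[volume.restrict S] fun z => S.indicator g (z + v) := by
  have h₁ := restrictL2_coe (S := S) (translateL2 v (extendL2 S g))
  have h₂ := ae_restrict_of_ae (s := S) (translateL2_coe v (extendL2 S g))
  have h₃ := ae_restrict_of_ae (s := S)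
    ((measurePreserving_add_right volume v).quasiMeasurePreserving.ae (extendL2_coe hS g))
  filter_upwards [h₁, h₂, h₃] with z h₁ h₂ h₃
  rw [← h₃, ← h₂, ← h₁]
  rfl

theorem inner_shift (hS : MeasurableSet S) (v : SpaceTime n) (f g : L2 S) :
    ⟪shift S v f, g⟫ = ∫ z, S.indicator f (z + v) * S.indicator g z := by
  rw [inner_L2, ← integral_indicator hS]
  refine integral_congr_ae ?_
  filter_upwards [(ae_restrict_iff' hS).1 (shift_coe hS v f)] with z h
  by_cases hz : z ∈ S
  · simp [hz, h hz]
  · simp [hz]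

theorem shift_adjoint (hS : MeasurableSet S) (v : SpaceTime n) (f g : L2 S) :
    ⟪shift S v f, g⟫ = ⟪f, shift S (-v) g⟫ := by
  rw [inner_shift hS, real_inner_comm, inner_shift hS,
    ← integral_add_right_eq_self (fun z => S.indicator g (z + -v) * S.indicator f z) v]
  simp [mul_comm]

theorem continuous_shift (g : L2 S) : Continuous fun v => shift S v g :=
  (restrictL2 S).continuous.comp (continuous_translateL2 (extendL2 S g))

theorem shift_zero (hS : MeasurableSet S) (g : L2 S) : shift S 0 g = g := by
  refine Lp.ext ?_
  filter_upwards [shift_coe hS 0 g, ae_restrict_mem hS] with z h hz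
  rw [h]
  simp [hz]

theorem norm_shift_le (hS : MeasurableSet S) (v : SpaceTime n) (g : L2 S) :
    ‖shift S v g‖ ≤ ‖g‖ := by
  have h₁ : ∀ x : L2 S, ‖extendL2 S x‖ = ‖x‖ := fun x => by
    rw [Lp.norm_def, Lp.norm_def, eLpNorm_congr_ae (extendL2_coe hS x),
      eLpNorm_indicator_eq_eLpNorm_restrict hS]
  have h₂ : ∀ x : Lp ℝ 2 (volume : Measure (SpaceTime n)), ‖restrictL2 S x‖ ≤ ‖x‖ := fun x => by
    rw [Lp.norm_def, Lp.norm_def, eLpNorm_congr_ae (restrictL2_coe x)]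
    exact ENNReal.toReal_mono (Lp.eLpNorm_ne_top x) (eLpNorm_restrict_le _ _ _ _)
  calc ‖shift S v g‖ ≤ ‖translateL2 v (extendL2 S g)‖ := h₂ _
    _ = ‖extendL2 S g‖ := Lp.norm_compMeasurePreserving _ _
    _ = ‖g‖ := h₁ g

/-- The intermediate truncation to `S` destroys nothing when a path that starts and ends in `S`
cannot be outside at its middle point; that is the hypothesis `h`. -/
theorem shift_shift (hS : MeasurableSet S) {v w : SpaceTime n}
    (h : ∀ z ∈ S, z + v + w ∈ S → z + v ∈ S) (g : L2 S) :
    shift S v (shift S w g) = shift S (v + w) g := by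
  refine Lp.ext ?_
  have h₁ := ae_restrict_of_ae (s := S)
    ((measurePreserving_add_right volume v).quasiMeasurePreserving.ae
      ((ae_restrict_iff' hS).1 (shift_coe hS w g)))
  filter_upwards [shift_coe hS v (shift S w g), shift_coe hS (v + w) g, h₁, ae_restrict_mem hS]
    with z h₂ h₃ h₄ hz
  rw [h₂, h₃, ← add_assoc]
  by_cases hv : z + v ∈ S
  · rw [Set.indicator_of_mem hv, h₄ hv]
  · rw [Set.indicator_of_notMem hv, Set.indicator_of_notMem (fun hw => hv (h z hz hw))]

/-- Multiplication by a bounded measurable function. -/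
noncomputable def mulL2 {b : SpaceTime n → ℝ} (hb : MemLp b ⊤ (volume.restrict S)) :
    L2 S →L[ℝ] L2 S :=
  (ContinuousLinearMap.mul ℝ ℝ).holderL (volume.restrict S) ⊤ 2 2 hb.toLp

variable {b c : SpaceTime n → ℝ}

theorem mulL2_coe (hb : MemLp b ⊤ (volume.restrict S)) (g : L2 S) :
    mulL2 hb g =ᵐ[volume.restrict S] fun z => b z * g z := by
  filter_upwards [(ContinuousLinearMap.mul ℝ ℝ).coeFn_holder (r := 2) hb.toLp g, hb.coeFn_toLp]
    with z h₁ h₂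
  rw [← h₂]
  exact h₁

theorem mulL2_adjoint (hb : MemLp b ⊤ (volume.restrict S)) (f g : L2 S) :
    ⟪mulL2 hb f, g⟫ = ⟪f, mulL2 hb g⟫ := by
  rw [inner_L2, inner_L2]
  refine integral_congr_ae ?_
  filter_upwards [mulL2_coe hb f, mulL2_coe hb g] with z h₁ h₂
  rw [h₁, h₂]
  ring

theorem norm_mulL2_le (hb : MemLp b ⊤ (volume.restrict S)) {C : ℝ}
    (hC : ∀ z, |b z| ≤ C) (g : L2 S) : ‖mulL2 hb g‖ ≤ C * ‖g‖ := by
  refine Lp.norm_le_mul_norm_of_ae_le_mul ?_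
  filter_upwards [mulL2_coe hb g] with z h
  rw [h, norm_mul]
  exact mul_le_mul_of_nonneg_right (hC z) (norm_nonneg _)

theorem mulL2_shift (hS : MeasurableSet S) (hb : MemLp b ⊤ (volume.restrict S)) {v : SpaceTime n}
    (hv : ∀ z, b (z + v) = b z) (g : L2 S) :
    mulL2 hb (shift S v g) = shift S v (mulL2 hb g) := by
  refine Lp.ext ?_
  have h₁ := ae_restrict_of_ae (s := S)
    ((measurePreserving_add_right volume v).quasiMeasurePreserving.ae
      ((ae_restrict_iff' hS).1 (mulL2_coe hb g)))
  filter_upwards [mulL2_coe hb (shift S v g), shift_coe hS v g, shift_coe hS v (mulL2 hb g), h₁]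
    with z h₁ h₂ h₃ h₄
  rw [h₁, h₂, h₃]
  by_cases hz : z + v ∈ S
  · rw [Set.indicator_of_mem hz, Set.indicator_of_mem hz, h₄ hz, hv]
  · rw [Set.indicator_of_notMem hz, Set.indicator_of_notMem hz, mul_zero]

end ShiftOperators

/-! ### Weak derivatives as generators of translations -/

section TestFunctions

variable {n : ℕ} {S : Set (SpaceTime n)}

theorem eq_zero_of_test (hS : IsOpen S) (g : L2 S)
    (h : ∀ φ, IsTestFunction S φ → ∫ z in S, g z * φ z = 0) : g = 0 := by
  have hm : MemLp (S.indicator g) 2 (volume : Measure (SpaceTime n)) :=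
    (memLp_indicator_iff_restrict hS.measurableSet).2 (Lp.memLp g)
  have hl : LocallyIntegrable (S.indicator g) (volume : Measure (SpaceTime n)) :=
    hm.locallyIntegrable (by norm_num)
  have h₀ := hS.ae_eq_zero_of_integral_contDiff_smul_eq_zero
    (hl.locallyIntegrableOn S) (fun φ h₁ h₂ h₃ => by
      rw [← h φ ⟨h₁, h₂, h₃⟩, ← integral_indicator hS.measurableSet]
      refine integral_congr_ae (ae_of_all _ fun z => ?_)
      by_cases hz : z ∈ S
      · simp [hz, mul_comm]
      · simp [hz])
  refine Lp.ext ?_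
  filter_upwards [ae_restrict_of_ae h₀, ae_restrict_mem hS.measurableSet,
    Lp.coeFn_zero ℝ 2 (volume.restrict S)] with z h₁ hz h₂
  rw [h₂, Pi.zero_apply, ← h₁ hz, Set.indicator_of_mem hz]

theorem memLp_of_smooth {φ : SpaceTime n → ℝ} (h₁ : ContDiff ℝ ∞ φ) (h₂ : HasCompactSupport φ)
    (S : Set (SpaceTime n)) : MemLp φ 2 (volume.restrict S) :=
  (h₁.continuous.memLp_of_hasCompactSupport h₂).restrict S

theorem smooth_fderiv_apply {φ : SpaceTime n → ℝ} (h₁ : ContDiff ℝ ∞ φ) (v : SpaceTime n) :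
    ContDiff ℝ ∞ fun z => fderiv ℝ φ z v :=
  (h₁.fderiv_right (m := ∞) (by simp)).clm_apply contDiff_const

theorem hasCompactSupport_fderiv_apply {φ : SpaceTime n → ℝ} (h₂ : HasCompactSupport φ)
    (v : SpaceTime n) : HasCompactSupport fun z => fderiv ℝ φ z v :=
  h₂.fderiv_apply ℝ v

theorem IsTestFunction.comp_sub {A B : Set (SpaceTime n)} {φ : SpaceTime n → ℝ}
    (hφ : IsTestFunction A φ) {w : SpaceTime n} (hw : ∀ z ∈ A, z + w ∈ B) :
    IsTestFunction B fun z => φ (z - w) where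
  smooth := hφ.smooth.comp (by fun_prop)
  compact := hφ.compact.comp_homeomorph (Homeomorph.subRight w)
  support_subset := fun z hz => by
    have h := tsupport_comp_subset_preimage φ (f := fun z => z - w) (by fun_prop) hz
    simpa using hw _ (hφ.support_subset h)

theorem fderiv_comp_sub_apply {φ : SpaceTime n → ℝ} (w v z : SpaceTime n) :
    fderiv ℝ (fun z => φ (z - w)) z v = fderiv ℝ φ (z - w) v := by
  rw [fderiv_comp_sub]

/-- The integral is a convolution of `G` with the reflected `φ`, evaluated at `s • v`, and the
derivative falls on the smooth factor. -/
theorem hasDerivAt_integral_mul_shift {G φ : SpaceTime n → ℝ} (hG : LocallyIntegrable G volume)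
    (h₁ : ContDiff ℝ ∞ φ) (h₂ : HasCompactSupport φ) (v : SpaceTime n) (s : ℝ) :
    HasDerivAt (fun s : ℝ => ∫ z, G z * φ (z - s • v))
      (-∫ z, G z * fderiv ℝ φ (z - s • v) v) s := by
  let ψ : SpaceTime n → ℝ := fun z => φ (-z)
  have hψ : ContDiff ℝ ∞ ψ := h₁.comp contDiff_neg
  have hψc : HasCompactSupport ψ := h₂.comp_homeomorph (Homeomorph.neg _)
  have hd := hψc.hasFDerivAt_convolution_right (ContinuousLinearMap.mul ℝ ℝ) hG
    (hψ.of_le (by simp)) (s • v)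
  have hl : HasDerivAt (fun s : ℝ => s • v) v s := by
    simpa using (hasDerivAt_id s).smul_const v
  have hc := hd.comp_hasDerivAt s hl
  rw [convolution_precompR_apply (ContinuousLinearMap.mul ℝ ℝ) hG (hψc.fderiv ℝ)
    (hψ.continuous_fderiv (by simp))] at hc
  have e₁ : (fun s : ℝ => ∫ z, G z * φ (z - s • v)) =
      (convolution G ψ (ContinuousLinearMap.mul ℝ ℝ) volume) ∘ fun s => s • v := by
    ext r
    simp [convolution, ψ]
  have e₂ : -∫ z, G z * fderiv ℝ φ (z - s • v) v =
      convolution G (fun a => fderiv ℝ ψ a v) (ContinuousLinearMap.mul ℝ ℝ) volume (s • v) := by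
    have e : ∀ y, fderiv ℝ ψ y v = -fderiv ℝ φ (-y) v := fun y => by
      have h := ((h₁.differentiable (by simp) (-y)).hasFDerivAt.comp y
        (hasFDerivAt_id y).neg).fderiv
      rw [show ψ = φ ∘ fun z => -z from rfl]
      simpa using congrArg (fun L => L v) h
    rw [← integral_neg]
    simp [convolution, e]
  rw [e₁, e₂]
  exact hc

theorem integral_fderiv_mul_symm {φ ψ : SpaceTime n → ℝ} (h₁ : ContDiff ℝ ∞ φ)
    (h₂ : HasCompactSupport φ) (h₃ : ContDiff ℝ ∞ ψ) (h₄ : HasCompactSupport ψ)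
    (hS : tsupport φ ⊆ S ∨ tsupport ψ ⊆ S) (v : SpaceTime n) :
    ∫ z in S, ψ z * fderiv ℝ φ z v = -∫ z in S, fderiv ℝ ψ z v * φ z := by
  have hz : ∀ z ∉ S, φ z = 0 ∧ fderiv ℝ φ z = 0 ∨ ψ z = 0 ∧ fderiv ℝ ψ z = 0 := by
    intro z hz
    refine hS.imp (fun h => ?_) (fun h => ?_)
    · exact ⟨image_eq_zero_of_notMem_tsupport fun hm => hz (h hm),
        fderiv_of_notMem_tsupport ℝ fun hm => hz (h hm)⟩
    · exact ⟨image_eq_zero_of_notMem_tsupport fun hm => hz (h hm),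
        fderiv_of_notMem_tsupport ℝ fun hm => hz (h hm)⟩
  rw [setIntegral_eq_integral_of_forall_compl_eq_zero,
    setIntegral_eq_integral_of_forall_compl_eq_zero]
  · refine integral_mul_fderiv_eq_neg_fderiv_mul_of_integrable ?_ ?_ ?_
      (fun x _ => h₃.differentiable (by simp) x) (fun x _ => h₁.differentiable (by simp) x)
    · exact ((smooth_fderiv_apply h₃ v).continuous.mul h₁.continuous).integrable_of_hasCompactSupport
        h₂.mul_left
    · exact (h₃.continuous.mul (smooth_fderiv_apply h₁ v).continuous).integrable_of_hasCompactSupport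
        h₄.mul_right
    · exact (h₃.continuous.mul h₁.continuous).integrable_of_hasCompactSupport h₂.mul_left
  · intro z h
    rcases hz z h with ⟨a, b⟩ | ⟨a, b⟩ <;> simp [a, b]
  · intro z h
    rcases hz z h with ⟨a, b⟩ | ⟨a, b⟩ <;> simp [a, b]

/-- The semigroup of translations in the direction `v`. -/
noncomputable def dirShift (S : Set (SpaceTime n)) (v : SpaceTime n) (s : ℝ) : L2 S →L[ℝ] L2 S :=
  shift S (s • v)

theorem shiftPair_dirShift (hS : MeasurableSet S) {v : SpaceTime n}
    (hv : ∀ z ∈ S, ∀ s : ℝ, 0 ≤ s → z + s • v ∈ S) :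
    ShiftPair (dirShift S v) (dirShift S (-v)) where
  adj s x y := by
    rw [dirShift, dirShift, smul_neg]
    exact shift_adjoint hS _ _ _
  cont_left x := (continuous_shift x).comp (by fun_prop)
  cont_right x := (continuous_shift x).comp (by fun_prop)
  zero_left x := by rw [dirShift, zero_smul, shift_zero hS]
  zero_right x := by rw [dirShift, zero_smul, shift_zero hS]
  add_left s r x hs hr := by
    rw [dirShift, dirShift, dirShift, add_smul, shift_shift hS]
    exact fun z hz _ => hv z hz s hs
  add_right s r x hs hr := by
    rw [dirShift, dirShift, dirShift, add_smul, shift_shift hS]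
    intro z _ h
    have := hv _ h r hr
    rwa [smul_neg, smul_neg, add_assoc, neg_add_cancel, add_zero, ← smul_neg] at this

theorem dirShift_cancel (hS : MeasurableSet S) {v : SpaceTime n}
    (hv : ∀ z ∈ S, ∀ s : ℝ, 0 ≤ s → z + s • v ∈ S) (s r : ℝ) (x : L2 S) (hr : 0 ≤ r)
    (hrs : r ≤ s) : dirShift S v s (dirShift S (-v) r x) = dirShift S v (s - r) x := by
  rw [dirShift, dirShift, dirShift, sub_smul, shift_shift hS, smul_neg, sub_eq_add_neg]
  exact fun z hz _ => hv z hz s (hr.trans hrs)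

theorem inner_dirShift (hS : MeasurableSet S) {v : SpaceTime n} (g : L2 S) {φ : SpaceTime n → ℝ}
    (hφ : IsTestFunction S φ) (hm : MemLp φ 2 (volume.restrict S)) (r : ℝ) :
    ⟪dirShift S v r g, hm.toLp⟫ = ∫ z in S, g z * φ (z - r • v) := by
  have h₁ : ∀ z, S.indicator φ z = φ z := fun z => by
    refine congrFun (Set.indicator_eq_self.2 fun z hz => ?_) z
    exact hφ.support_subset (subset_tsupport _ hz)
  rw [dirShift, inner_shift hS, ← integral_indicator hS,
    ← integral_sub_right_eq_self _ (r • v)]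
  refine integral_congr_ae ?_
  filter_upwards [(measurePreserving_sub_right volume (r • v)).quasiMeasurePreserving.ae
    ((ae_restrict_iff' hS).1 hm.coeFn_toLp)] with z hz
  have h₂ : S.indicator hm.toLp (z - r • v) = φ (z - r • v) := by
    rw [← h₁ (z - r • v)]
    by_cases h : z - r • v ∈ S
    · rw [Set.indicator_of_mem h, Set.indicator_of_mem h, hz h]
    · rw [Set.indicator_of_notMem h, Set.indicator_of_notMem h]
  rw [h₂, sub_add_cancel]
  by_cases h : z ∈ S
  · simp [h]
  · simp [h]

/-- By `H` the pairing of the translate of `g` with `φ` has as derivative in the translation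
parameter the pairing of the translate of `h`. Integrating this and varying `φ` gives the identity.
`H` is asked for all translates of `φ` because these may leave `S`. -/
theorem gen_of_test (hS : IsOpen S) {v : SpaceTime n}
    (hp : ShiftPair (dirShift S v) (dirShift S (-v))) {g h : L2 S}
    (H : ∀ φ, IsTestFunction S φ → ∀ s : ℝ, 0 ≤ s →
      ∫ z in S, g z * fderiv ℝ φ (z - s • v) v = -∫ z in S, h z * φ (z - s • v)) :
    Gen (dirShift S v) g h := by
  intro s hs
  rw [← sub_eq_zero]
  refine eq_zero_of_test hS _ fun φ hφ => ?_
  have hm := memLp_of_smooth hφ.smooth hφ.compact S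
  have hl : LocallyIntegrable (S.indicator g) (volume : Measure (SpaceTime n)) :=
    ((memLp_indicator_iff_restrict hS.measurableSet).2 (Lp.memLp g)).locallyIntegrable
      (by norm_num)
  have hind : ∀ ψ : SpaceTime n → ℝ,
      ∫ z, S.indicator g z * ψ z = ∫ z in S, g z * ψ z := fun ψ => by
    rw [← integral_indicator hS.measurableSet]
    refine integral_congr_ae (ae_of_all _ fun z => ?_)
    by_cases hz : z ∈ S <;> simp [hz]
  have e₀ : ∀ x : L2 S, ∫ z in S, x z * φ z = ⟪x, hm.toLp⟫ := fun x => by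
    rw [inner_L2]
    refine integral_congr_ae ?_
    filter_upwards [hm.coeFn_toLp] with z hz
    rw [hz]
  have hd : ∀ r ∈ Set.uIcc 0 s, HasDerivAt (fun r : ℝ => ⟪dirShift S v r g, hm.toLp⟫)
      ⟪dirShift S v r h, hm.toLp⟫ r := by
    intro r hr
    rw [Set.uIcc_of_le hs] at hr
    have h₁ := hasDerivAt_integral_mul_shift hl hφ.smooth hφ.compact v r
    simp only [hind] at h₁
    rw [H φ hφ r hr.1, neg_neg] at h₁
    simp only [inner_dirShift hS.measurableSet _ hφ hm]
    exact h₁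
  have hI := intervalIntegral.integral_eq_sub_of_hasDerivAt hd
    (((hp.cont_left h).inner continuous_const).intervalIntegrable _ _)
  rw [e₀, inner_sub_left, inner_sub_left, hp.inner_integral, hI, hp.zero_left, sub_self]

theorem gen_of_smooth (hS : IsOpen S) {v : SpaceTime n}
    (hv : ∀ z ∈ S, ∀ s : ℝ, 0 ≤ s → z + s • v ∈ S) {ψ : SpaceTime n → ℝ}
    (h₁ : ContDiff ℝ ∞ ψ) (h₂ : HasCompactSupport ψ) :
    Gen (dirShift S v) (memLp_of_smooth h₁ h₂ S).toLp
      (memLp_of_smooth (smooth_fderiv_apply h₁ v) (hasCompactSupport_fderiv_apply h₂ v) S).toLp := by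
  refine gen_of_test hS (shiftPair_dirShift hS.measurableSet hv) fun φ hφ s hs => ?_
  have hφ' := hφ.comp_sub (w := s • v) fun z hz => hv z hz s hs
  have e := integral_fderiv_mul_symm hφ'.smooth hφ'.compact h₁ h₂ (.inl hφ'.support_subset) v
  simp only [fderiv_comp_sub_apply] at e
  convert! e using 1
  · refine integral_congr_ae ?_
    filter_upwards [(memLp_of_smooth h₁ h₂ S).coeFn_toLp] with z hz
    rw [hz]
  · congr 1
    refine integral_congr_ae ?_
    filter_upwards [(memLp_of_smooth (smooth_fderiv_apply h₁ v)
      (hasCompactSupport_fderiv_apply h₂ v) S).coeFn_toLp] with z hz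
    rw [hz]

theorem gen_neg_of_test (hS : IsOpen S) {v : SpaceTime n}
    (hv : ∀ z ∈ S, ∀ s : ℝ, 0 ≤ s → z + s • v ∈ S) {ψ : SpaceTime n → ℝ}
    (hψ : IsTestFunction S ψ) :
    Gen (dirShift S (-v)) (memLp_of_smooth hψ.smooth hψ.compact S).toLp
      (-(memLp_of_smooth (smooth_fderiv_apply hψ.smooth v)
        (hasCompactSupport_fderiv_apply hψ.compact v) S).toLp) := by
  refine gen_of_test hS ?_ fun φ hφ s hs => ?_
  · rw [neg_neg]
    exact (shiftPair_dirShift hS.measurableSet hv).symm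
  have hφ' := hφ.comp_sub (w := s • -v) (B := Set.univ) fun z hz => trivial
  have e := integral_fderiv_mul_symm hφ'.smooth hφ'.compact hψ.smooth hψ.compact
    (.inr hψ.support_subset) (-v)
  simp only [fderiv_comp_sub_apply] at e
  convert! e using 1
  · refine integral_congr_ae ?_
    filter_upwards [(memLp_of_smooth hψ.smooth hψ.compact S).coeFn_toLp] with z hz
    rw [hz]
  · congr 1
    refine integral_congr_ae ?_
    filter_upwards [Lp.coeFn_neg (memLp_of_smooth (smooth_fderiv_apply hψ.smooth v)
      (hasCompactSupport_fderiv_apply hψ.compact v) S).toLp,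
      (memLp_of_smooth (smooth_fderiv_apply hψ.smooth v)
      (hasCompactSupport_fderiv_apply hψ.compact v) S).coeFn_toLp] with z hz hz'
    rw [hz, Pi.neg_apply, hz', map_neg]

theorem inner_smooth {ψ : SpaceTime n → ℝ} (hm : MemLp ψ 2 (volume.restrict S)) (g : L2 S) :
    ⟪g, hm.toLp⟫ = ∫ z in S, g z * ψ z := by
  rw [inner_L2]
  refine integral_congr_ae ?_
  filter_upwards [hm.coeFn_toLp] with z hz
  rw [hz]

/-- Translates of test functions into the domain are again test functions, which gives one
direction; the other is adjointness, as test functions lie in the domain of the adjoint generator.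
-/
theorem isWeakDeriv_iff (hS : IsOpen S) {v : SpaceTime n}
    (hv : ∀ z ∈ S, ∀ s : ℝ, 0 ≤ s → z + s • v ∈ S) {g h : L2 S} :
    IsWeakDeriv v g h ↔ Gen (dirShift S v) g h := by
  refine ⟨fun H => ?_, fun H φ hφ => ?_⟩
  · refine gen_of_test hS (shiftPair_dirShift hS.measurableSet hv) fun φ hφ s hs => ?_
    have e := H _ (hφ.comp_sub (w := s • v) fun z hz => hv z hz s hs)
    simpa only [fderiv_comp_sub_apply] using e
  · have e := H.adjoint (shiftPair_dirShift hS.measurableSet hv) (gen_neg_of_test hS hv hφ)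
    rw [real_inner_comm, inner_smooth, inner_neg_left, real_inner_comm, inner_smooth] at e
    rw [e, neg_neg]

theorem isWeakDeriv_neg {v : SpaceTime n} {g h : L2 S} :
    IsWeakDeriv (-v) g (-h) ↔ IsWeakDeriv v g h := by
  refine forall₂_congr fun φ hφ => ?_
  have e : ∫ z in S, (-h) z * φ z = -∫ z in S, h z * φ z := by
    rw [← integral_neg]
    refine integral_congr_ae ?_
    filter_upwards [Lp.coeFn_neg h] with z hz
    rw [hz]
    simp
  rw [e]
  simp only [map_neg, mul_neg, integral_neg, neg_inj]

end TestFunctions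

/-! ### Integration by parts and the basic estimates -/

section AbstractEstimates

variable {H : Type*} [NormedAddCommGroup H] [InnerProductSpace ℝ H] [CompleteSpace H] {n : ℕ}

/-- Commuting semigroups of translations, `none` being the backward time direction and `some i` the
`i`-th spatial direction. -/
structure ShiftSystem (n : ℕ) (H : Type*) [NormedAddCommGroup H] [InnerProductSpace ℝ H] where
  /-- the semigroups -/
  T : Option (Fin (n + 1)) → ℝ → H →L[ℝ] H
  /-- the adjoint semigroups -/
  T' : Option (Fin (n + 1)) → ℝ → H →L[ℝ] H
  pair : ∀ c, ShiftPair (T c) (T' c)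
  cancel : ∀ c s r x, 0 ≤ r → r ≤ s → T c s (T' c r x) = T c (s - r) x
  comm : ∀ c c', c ≠ c' → ∀ s r x, T c s (T c' r x) = T c' r (T c s x)
  comm' : ∀ c c', c ≠ c' → ∀ s r x, T c s (T' c' r x) = T' c' r (T c s x)
  contraction : ∀ c s x, ‖T c s x‖ ≤ ‖x‖

/-- `B` commutes with the family `V`. -/
def Commutes (B : H →L[ℝ] H) (V : ℝ → H →L[ℝ] H) : Prop := ∀ s x, B (V s x) = V s (B x)

/-- The tuple `(u, Du, D²u, u_t)` of an element of the solution space. -/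
structure InSpace (τ : ShiftSystem n H) (b : BoundaryKind) (u : H) (g : Fin (n + 1) → H)
    (h : Fin (n + 1) → Fin (n + 1) → H) (d : H) : Prop where
  grad : ∀ i, Gen (τ.T (some i)) u (g i)
  hess : ∀ i j, Gen (τ.T (some j)) (g i) (h i j)
  time : Gen (τ.T none) u (-d)
  bc_first : match b with
    | .dirichlet => Gen (τ.T' (some 0)) u (-g 0)
    | .neumann => Gen (τ.T' (some 0)) (g 0) (-h 0 0)
  bc : ∀ i, i ≠ 0 → Gen (τ.T' (some i)) u (-g i)

variable {τ : ShiftSystem n H} {b : BoundaryKind} {u d : H} {g : Fin (n + 1) → H}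
  {h : Fin (n + 1) → Fin (n + 1) → H}

theorem InSpace.bc_or (hu : InSpace τ b u g h d) (k : Fin (n + 1)) :
    Gen (τ.T' (some k)) u (-g k) ∨ Gen (τ.T' (some k)) (g k) (-h k k) := by
  by_cases hk : k = 0
  · subst hk
    have := hu.bc_first
    cases b
    · exact .inl this
    · exact .inr this
  · exact .inl (hu.bc k hk)

theorem InSpace.hess_symm (hu : InSpace τ b u g h d) (i j : Fin (n + 1)) : h i j = h j i := by
  by_cases hij : i = j
  · rw [hij]
  have e := Gen.mixed (τ.pair (some j)) (τ.pair (some i))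
    (τ.comm _ _ fun h => hij (Option.some_injective _ h).symm) (hu.grad j) (hu.grad i) (hu.hess j i)
  exact (hu.hess i j).unique (τ.pair _) e

/-- A derivative tangential to a face commutes with the translations across it, and so preserves the
zero boundary values. -/
theorem InSpace.dirichlet_grad (hu : InSpace τ b u g h d) {i j : Fin (n + 1)} (hij : i ≠ j)
    (hj : Gen (τ.T' (some j)) u (-g j)) : Gen (τ.T' (some j)) (g i) (-h i j) := by
  rw [hu.hess_symm i j]
  exact Gen.mixed (τ.pair (some j)).symm (τ.pair (some i))
    (fun s r x => (τ.comm' (some i) (some j) (by simpa using hij) r s x).symm) hj (hu.grad i)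
    (hu.hess j i).neg

/-- Formally both sides equal `⟪B W' P' x, v⟫`, with primes for generators. Since `x` has no second
derivatives of this kind, `W'` is replaced by its difference quotient, which preserves the domain of
`P'`, and the limit is taken at the end. -/
theorem inner_generators_eq {V W P Q : ℝ → H →L[ℝ] H} {v a x y z c : H} {B : H →L[ℝ] H}
    (hV : ShiftPair V W) (hP : ShiftPair P Q) (hWP : ∀ s r x, W s (P r x) = P r (W s x))
    (hBW : Commutes B W) (hBP : Commutes B P) (h₁ : Gen V v a) (h₂ : Gen W x z)
    (h₃ : Gen P x y) (h₄ : Gen Q v c) : ⟪B y, a⟫ = ⟪B z, c⟫ := by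
  have e₁ := h₁.tendsto_inner hV (B y)
  have e₂ := (h₂.map hV.symm B hBW).tendsto_inner hV.symm c
  rw [real_inner_comm] at e₂
  refine tendsto_nhds_unique e₁ (e₂.congr fun s => ?_)
  congr 1
  have e₃ := (((h₃.map hP (W s) (hWP s)).sub hP h₃).map hP B hBP).adjoint hP h₄
  rw [← hBW, ← map_sub, ← e₃, real_inner_comm, map_sub, inner_sub_left, hBW, inner_sub_right,
    hV.symm.adj]

/-- Integration by parts in `x_k` and `x_j`. On the face `x_k = 0` the boundary term vanishes
because either `D_i u` or `D_k u` is zero there; on `x_j = 0` because `D_k u` is zero there. -/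
theorem InSpace.inner_hess (hu : InSpace τ b u g h d) {i j k : Fin (n + 1)} (hik : i ≠ k)
    (hjk : j ≠ k) (hj : Gen (τ.T' (some j)) u (-g j)) {B : H →L[ℝ] H}
    (hBk : Commutes B (τ.T (some k))) (hBk' : Commutes B (τ.T' (some k)))
    (hBj : Commutes B (τ.T (some j))) : ⟪B (h i j), h k k⟫ = ⟪B (h i k), h j k⟫ := by
  have h₄ := hu.dirichlet_grad hjk.symm hj
  have hkj : (some k : Option (Fin (n + 1))) ≠ some j := by simpa using hjk.symm
  rcases hu.bc_or k with hk | hk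
  · have e := inner_generators_eq (τ.pair (some k)) (τ.pair (some j))
      (fun s r x => (τ.comm' _ _ hkj.symm r s x).symm) hBk' hBj (hu.hess k k)
      (hu.dirichlet_grad hik hk) (hu.hess i j) h₄
    rw [e, map_neg, inner_neg_neg, hu.hess_symm k j]
  · have e := inner_generators_eq (τ.pair (some k)).symm (τ.pair (some j))
      (τ.comm _ _ hkj) hBk hBj hk (hu.hess i k) (hu.hess i j) h₄
    rw [inner_neg_right, inner_neg_right, neg_inj, hu.hess_symm k j] at e
    exact e

/-- In the boundary term one of the factors `u`, `D_k u` vanishes, whichever condition is imposed.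
-/
theorem InSpace.inner_hess_self (hu : InSpace τ b u g h d) {k : Fin (n + 1)} {B : H →L[ℝ] H}
    (hBk : Commutes B (τ.T (some k))) (hBk' : Commutes B (τ.T' (some k))) :
    ⟪B u, h k k⟫ = -⟪B (g k), g k⟫ := by
  rcases hu.bc_or k with hk | hk
  · have e := (hu.hess k k).adjoint (τ.pair (some k)) (hk.map (τ.pair (some k)).symm B hBk')
    rw [e, map_neg, inner_neg_left]
  · have e := ((hu.grad k).map (τ.pair (some k)) B hBk).adjoint (τ.pair (some k)) hk
    rw [real_inner_comm _ (B (g k)), e, inner_neg_left, neg_neg, real_inner_comm]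

theorem inner_shift_le (τ : ShiftSystem n H) {Q : H →L[ℝ] H} (hQ : ∀ x y, ⟪Q x, y⟫ = ⟪x, Q y⟫)
    (hQt : Commutes Q (τ.T none)) (s : ℝ) (x : H) : ⟪Q (Q (τ.T none s x - x)), x⟫ ≤ 0 := by
  rw [hQ, map_sub, hQt, inner_sub_left, sub_nonpos]
  calc ⟪τ.T none s (Q x), Q x⟫ ≤ ‖τ.T none s (Q x)‖ * ‖Q x‖ := real_inner_le_norm _ _
    _ ≤ ‖Q x‖ * ‖Q x‖ := by gcongr; exact τ.contraction _ _ _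
    _ = ⟪Q x, Q x⟫ := (real_inner_self_eq_norm_mul_norm _).symm

theorem Commutes.comp {B C : H →L[ℝ] H} {V : ℝ → H →L[ℝ] H} (hB : Commutes B V)
    (hC : Commutes C V) : Commutes (B ∘L C) V := fun s x => by
  simp only [ContinuousLinearMap.comp_apply]
  rw [hC, hB]

theorem Commutes.sub {B C : H →L[ℝ] H} {V : ℝ → H →L[ℝ] H} (hB : Commutes B V)
    (hC : Commutes C V) : Commutes (B - C) V := fun s x => by
  simp only [sub_apply, map_sub]
  rw [hC, hB]

theorem commutes_id (V : ℝ → H →L[ℝ] H) : Commutes (ContinuousLinearMap.id ℝ H) V :=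
  fun _ _ => rfl

/-- Formally the left side is minus half the squared norm of `Q D_k u` at the final time. With
difference quotients in time, the sign comes from the translations being contractions. -/
theorem InSpace.inner_time_hess (hu : InSpace τ b u g h d) {k : Fin (n + 1)} {Q : H →L[ℝ] H}
    (hQ : ∀ x y, ⟪Q x, y⟫ = ⟪x, Q y⟫) (hQt : Commutes Q (τ.T none))
    (hQk : Commutes Q (τ.T (some k))) (hQk' : Commutes Q (τ.T' (some k))) :
    ⟪Q (Q d), h k k⟫ ≤ 0 := by
  have e := hu.time.tendsto_inner (τ.pair none) (Q (Q (h k k)))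
  have : 0 ≤ ⟪Q (Q (h k k)), -d⟫ := by
    refine ge_of_tendsto e ?_
    filter_upwards [self_mem_nhdsWithin] with s hs
    refine mul_nonneg (inv_nonneg.2 (le_of_lt hs)) ?_
    have hT : Commutes (τ.T none s) (τ.T (some k)) := fun r x => τ.comm _ _ (by simp) _ _ _
    have hT' : Commutes (τ.T none s) (τ.T' (some k)) := fun r x => τ.comm' _ _ (by simp) _ _ _
    have e₁ := hu.inner_hess_self
      (((hQk.comp hQk).comp (hT.sub (commutes_id _)))) (((hQk'.comp hQk').comp
        (hT'.sub (commutes_id _))))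
    simp only [ContinuousLinearMap.comp_apply, sub_apply,
      ContinuousLinearMap.id_apply] at e₁
    rw [hQ, hQ, real_inner_comm, e₁]
    linarith [inner_shift_le τ hQ hQt s (g k)]
  rw [inner_neg_right, hQ, hQ, real_inner_comm] at this
  linarith

theorem InSpace.inner_time_self (hu : InSpace τ b u g h d) {Q : H →L[ℝ] H}
    (hQ : ∀ x y, ⟪Q x, y⟫ = ⟪x, Q y⟫) (hQt : Commutes Q (τ.T none)) :
    0 ≤ ⟪Q (Q u), d⟫ := by
  have e := hu.time.tendsto_inner (τ.pair none) (Q (Q u))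
  have : ⟪Q (Q u), -d⟫ ≤ 0 := by
    refine le_of_tendsto e ?_
    filter_upwards [self_mem_nhdsWithin] with s hs
    refine mul_nonpos_of_nonneg_of_nonpos (inv_nonneg.2 (le_of_lt hs)) ?_
    rw [hQ, hQ, real_inner_comm]
    exact inner_shift_le τ hQ hQt s u
  rw [inner_neg_right] at this
  linarith

/-- Operators `A i j` and `Q ∘ Q` acting as the coefficients of `-Q² u_t + A_{ij} D_{ij} u - λ Q² u`. -/
structure CoeffOps (τ : ShiftSystem n H) (c C : ℝ) (A : Fin (n + 1) → Fin (n + 1) → H →L[ℝ] H)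
    (Q : H →L[ℝ] H) : Prop where
  comm : ∀ i j k, k ≠ Fin.last n → Commutes (A i j) (τ.T (some k))
  comm' : ∀ i j k, k ≠ Fin.last n → Commutes (A i j) (τ.T' (some k))
  comm_last : Commutes (A (Fin.last n) (Fin.last n)) (τ.T (some (Fin.last n)))
  symm_A : ∀ i j x y, ⟪A i j x, y⟫ = ⟪x, A i j y⟫
  symm : ∀ x y, ⟪Q x, y⟫ = ⟪x, Q y⟫
  comm_time : Commutes Q (τ.T none)
  comm_Q : ∀ k, k ≠ Fin.last n → Commutes Q (τ.T (some k))
  comm_Q' : ∀ k, k ≠ Fin.last n → Commutes Q (τ.T' (some k))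
  coercive : ∀ x : Fin (n + 1) → H, c * ∑ i, ‖x i‖ ^ 2 ≤ ∑ i, ∑ j, ⟪A i j (x i), x j⟫
  bound : ∀ i j x, ‖A i j x‖ ≤ C * ‖x‖
  lower_Q : ∀ x, c * ‖x‖ ^ 2 ≤ ‖Q x‖ ^ 2
  bound_Q : ∀ x, ‖Q (Q x)‖ ≤ C * ‖x‖
  last : (∀ x, Q x = x) ∨ ∀ x, A (Fin.last n) (Fin.last n) x = x

variable {c C : ℝ} {A : Fin (n + 1) → Fin (n + 1) → H →L[ℝ] H} {Q : H →L[ℝ] H}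

theorem norm_le_of_sq_le {c x y : ℝ} (hc : 0 < c) (hx : 0 ≤ x) (h : c * x ^ 2 ≤ y * x)
    (hy : 0 ≤ y) : x ≤ c⁻¹ * y := by
  rcases hx.eq_or_lt with rfl | hx
  · positivity
  · rw [inv_mul_eq_div, le_div_iff₀ hc]
    nlinarith

/-- The estimate for `D D_k u`, with the sum restricted to the indices in `I`. -/
theorem InSpace.norm_hess_le (hu : InSpace τ b u g h d) (hA : CoeffOps τ c C A Q) (hc : 0 < c)
    {I : Finset (Fin (n + 1))} {k : Fin (n + 1)} (hk : k ≠ Fin.last n) (hkI : k ∈ I)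
    (hI : ∀ j ∈ I, j ≠ k → Gen (τ.T' (some j)) u (-g j)) {lam : ℝ} (hlam : 0 ≤ lam) {F : H}
    (hF : -Q (Q d) + ∑ i ∈ I, ∑ j ∈ I, A i j (h i j) - lam • Q (Q u) = F)
    {i : Fin (n + 1)} (hi : i ∈ I) : ‖h i k‖ ≤ c⁻¹ * ‖F‖ := by
  -- The coefficient must pass through translations in `x_k` and in one of `x_i`, `x_j`. If only `j`
  -- is the last index, symmetry of the Hessian allows the use of `x_i`; if both are last,
  -- `comm_last` applies.
  have hid : ∀ i ∈ I, ∀ j ∈ I, ⟪A i j (h i j), h k k⟫ = ⟪A i j (h i k), h j k⟫ := by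
    intro i hi j hj
    by_cases hjk : j = k
    · rw [hjk]
    by_cases hik : i = k
    · rw [hik, hu.hess_symm k j, hA.symm_A, real_inner_comm]
    by_cases hjl : j = Fin.last n
    · by_cases hil : i = Fin.last n
      · subst hil hjl
        exact hu.inner_hess hik hjk (hI _ hj hjk) (hA.comm _ _ k hk) (hA.comm' _ _ k hk)
          hA.comm_last
      · rw [hu.hess_symm i j, hu.inner_hess hjk hik (hI _ hi hik) (hA.comm _ _ k hk)
          (hA.comm' _ _ k hk) (hA.comm _ _ i hil), hA.symm_A, real_inner_comm]
    · exact hu.inner_hess hik hjk (hI _ hj hjk) (hA.comm _ _ k hk) (hA.comm' _ _ k hk)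
        (hA.comm _ _ j hjl)
  have hco : c * ∑ i ∈ I, ‖h i k‖ ^ 2 ≤ ∑ i ∈ I, ∑ j ∈ I, ⟪A i j (h i j), h k k⟫ := by
    -- Extension by zero outside `I` makes the principal block indexed by `I` inherit the
    -- coercivity.
    have e := hA.coercive fun i => if i ∈ I then h i k else 0
    have e₁ : ∀ i, ‖(if i ∈ I then h i k else 0)‖ ^ 2 = if i ∈ I then ‖h i k‖ ^ 2 else 0 := by
      intro i
      split_ifs <;> simp
    have e₂ : ∀ i j, ⟪A i j (if i ∈ I then h i k else 0), if j ∈ I then h j k else 0⟫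
        = if i ∈ I then (if j ∈ I then ⟪A i j (h i k), h j k⟫ else 0) else 0 := by
      intro i j
      split_ifs <;> simp
    simp only [e₁, e₂, Finset.sum_ite_mem, Finset.univ_inter, Finset.sum_ite_irrel,
      Finset.sum_const_zero] at e
    refine e.trans (le_of_eq ?_)
    exact Finset.sum_congr rfl fun i hi => Finset.sum_congr rfl fun j hj => (hid i hi j hj).symm
  have h₁ := hu.inner_time_hess hA.symm hA.comm_time (hA.comm_Q k hk) (hA.comm_Q' k hk)
  have h₂ := hu.inner_hess_self ((hA.comm_Q k hk).comp (hA.comm_Q k hk))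
    ((hA.comm_Q' k hk).comp (hA.comm_Q' k hk))
  simp only [ContinuousLinearMap.comp_apply] at h₂
  have h₃ : 0 ≤ ⟪Q (Q (g k)), g k⟫ := by
    rw [hA.symm]
    exact real_inner_self_nonneg
  have h₄ : ⟪F, h k k⟫ = -⟪Q (Q d), h k k⟫ + ∑ i ∈ I, ∑ j ∈ I, ⟪A i j (h i j), h k k⟫
      - lam * ⟪Q (Q u), h k k⟫ := by
    rw [← hF]
    simp only [inner_sub_left, inner_add_left, inner_neg_left, sum_inner, real_inner_smul_left]
  have h₅ : c * ∑ i ∈ I, ‖h i k‖ ^ 2 ≤ ‖F‖ * ‖h k k‖ := by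
    have := real_inner_le_norm F (h k k)
    have := mul_nonneg hlam h₃
    rw [h₂] at h₄
    linarith
  have h₆ : ∀ i ∈ I, c * ‖h i k‖ ^ 2 ≤ ‖F‖ * ‖h k k‖ := fun i hi => by
    refine le_trans ?_ h₅
    gcongr
    exact Finset.single_le_sum (f := fun i => ‖h i k‖ ^ 2) (fun _ _ => sq_nonneg _) hi
  -- The entry `h k k` comes first, as it also stands on the right-hand side of the bound for the
  -- other `h i k`.
  have h₇ := norm_le_of_sq_le hc (norm_nonneg _) (h₆ k hkI) (norm_nonneg F)
  refine le_of_sq_le_sq ?_ (by positivity)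
  have h₈ := h₆ i hi
  have h₉ : c * ‖h i k‖ ^ 2 ≤ c * (c⁻¹ * ‖F‖) ^ 2 := by
    refine h₈.trans ?_
    calc ‖F‖ * ‖h k k‖ ≤ ‖F‖ * (c⁻¹ * ‖F‖) := by gcongr
      _ = c * (c⁻¹ * ‖F‖) ^ 2 := by field_simp
  exact le_of_mul_le_mul_left h₉ hc

/-- The estimate in the last direction. -/
theorem InSpace.norm_last_le (hu : InSpace τ b u g h d) (hA : CoeffOps τ c C A Q) (hc : 0 < c)
    (hC : 0 ≤ C) {lam : ℝ} (hlam : 0 ≤ lam) {G : H}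
    (hG : -Q (Q d) + A (Fin.last n) (Fin.last n) (h (Fin.last n) (Fin.last n)) - lam • Q (Q u) = G) :
    ‖h (Fin.last n) (Fin.last n)‖ ≤ 2 * (1 + c⁻¹) * (1 + C * c⁻¹) ^ 2 * ‖G‖ ∧
    ‖d‖ ≤ 2 * (1 + c⁻¹) * (1 + C * c⁻¹) ^ 2 * ‖G‖ ∧
    lam * ‖u‖ ≤ 2 * (1 + c⁻¹) * (1 + C * c⁻¹) ^ 2 * ‖G‖ := by
  set l := Fin.last n
  have hi : 0 ≤ c⁻¹ := by positivity
  have he : 0 ≤ C * c⁻¹ := by positivity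
  have hGn := norm_nonneg G
  have hll := hu.inner_time_hess (k := l) (Q := ContinuousLinearMap.id ℝ H) (fun _ _ => rfl)
    (commutes_id _) (commutes_id _) (commutes_id _)
  simp only [ContinuousLinearMap.id_apply] at hll
  -- Without weight, test with `D_dd u`, and then `u_t + λu` with `u_t`. With leading coefficient
  -- one, test with `u_t`, then with `u`, and read off `D_dd u` from the equation. The constant in
  -- the statement dominates all those that arise.
  rcases hA.last with hQ | hA1
  · simp only [hQ] at hG
    have h₁ := hu.inner_hess_self (k := l) (commutes_id _) (commutes_id _)
    simp only [ContinuousLinearMap.id_apply] at h₁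
    have h₂ : c * ‖h l l‖ ^ 2 ≤ ⟪A l l (h l l), h l l⟫ := by
      have e := hA.coercive fun i => if i = l then h l l else 0
      have e₁ : ∀ i, ‖(if i = l then h l l else 0)‖ ^ 2 = if i = l then ‖h l l‖ ^ 2 else 0 := by
        intro i
        split_ifs <;> simp
      have e₂ : ∀ i j, ⟪A i j (if i = l then h l l else 0), if j = l then h l l else 0⟫
          = if i = l then (if j = l then ⟪A i j (h l l), h l l⟫ else 0) else 0 := by
        intro i j
        split_ifs <;> simp
      simpa only [e₁, e₂, Finset.sum_ite_eq', Finset.mem_univ, if_true, Finset.sum_ite_irrel,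
        Finset.sum_const_zero] using e
    have h₃ : ⟪G, h l l⟫ = -⟪d, h l l⟫ + ⟪A l l (h l l), h l l⟫ - lam * ⟪u, h l l⟫ := by
      rw [← hG]
      simp only [inner_sub_left, inner_add_left, inner_neg_left, real_inner_smul_left]
    have h₄ : ‖h l l‖ ≤ c⁻¹ * ‖G‖ := by
      refine norm_le_of_sq_le hc (norm_nonneg _) ?_ (norm_nonneg _)
      have := real_inner_le_norm G (h l l)
      have := mul_nonneg hlam (real_inner_self_nonneg (x := g l))
      rw [h₁] at h₃
      linarith
    have h₅ : ‖G - A l l (h l l)‖ ≤ (1 + C * c⁻¹) * ‖G‖ := by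
      calc ‖G - A l l (h l l)‖ ≤ ‖G‖ + C * (c⁻¹ * ‖G‖) :=
            (norm_sub_le _ _).trans (by gcongr; exact (hA.bound _ _ _).trans (by gcongr))
        _ = _ := by ring
    have h₆ : d + lam • u = -(G - A l l (h l l)) := by
      rw [← hG]
      abel
    have h₇ := hu.inner_time_self (Q := ContinuousLinearMap.id ℝ H) (fun _ _ => rfl)
      (commutes_id _)
    simp only [ContinuousLinearMap.id_apply] at h₇
    have h₈ : ‖d‖ ≤ (1 + C * c⁻¹) * ‖G‖ := by
      have e : ⟪d + lam • u, d⟫ ≤ ‖G - A l l (h l l)‖ * ‖d‖ := by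
        refine (real_inner_le_norm _ _).trans (le_of_eq ?_)
        rw [h₆, norm_neg]
      rw [inner_add_left, real_inner_smul_left, real_inner_self_eq_norm_sq] at e
      have := norm_le_of_sq_le one_pos (norm_nonneg d)
        (y := ‖G - A l l (h l l)‖) (by nlinarith [mul_nonneg hlam h₇]) (norm_nonneg _)
      rw [inv_one, one_mul] at this
      exact this.trans h₅
    have h₉ : lam * ‖u‖ ≤ 2 * ((1 + C * c⁻¹) * ‖G‖) := by
      have e : lam • u = -(G - A l l (h l l)) - d := by rw [← h₆]; abel
      have e' : ‖lam • u‖ ≤ ‖G - A l l (h l l)‖ + ‖d‖ := by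
        rw [e]
        exact (norm_sub_le _ _).trans (by rw [norm_neg])
      rw [norm_smul, Real.norm_of_nonneg hlam] at e'
      linarith
    have k₁ : c⁻¹ ≤ 2 * (1 + c⁻¹) * (1 + C * c⁻¹) ^ 2 := by
      nlinarith [mul_nonneg hi he, mul_nonneg (mul_nonneg hi he) he, mul_nonneg he he]
    have k₂ : 2 * (1 + C * c⁻¹) ≤ 2 * (1 + c⁻¹) * (1 + C * c⁻¹) ^ 2 := by
      nlinarith [mul_nonneg hi he, mul_nonneg (mul_nonneg hi he) he, mul_nonneg he he]
    refine ⟨h₄.trans (by gcongr), h₈.trans ?_, h₉.trans ?_⟩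
    · gcongr
      linarith
    · rw [← mul_assoc]
      gcongr
  · rw [hA1] at hG
    have hQu := hu.inner_time_self hA.symm hA.comm_time
    -- Pairing with `d`: the terms with `D_dd u` and `λu` have the good sign, and `‖Q d‖²` controls
    -- `‖d‖²`.
    have h₁ : ‖d‖ ≤ c⁻¹ * ‖G‖ := by
      refine norm_le_of_sq_le hc (norm_nonneg _) ?_ (norm_nonneg _)
      have e : ⟪-G, d⟫ = ‖Q d‖ ^ 2 - ⟪d, h l l⟫ + lam * ⟪Q (Q u), d⟫ := by
        rw [← hG]
        simp only [inner_sub_left, inner_add_left, inner_neg_left, real_inner_smul_left]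
        rw [hA.symm (Q d) d, real_inner_self_eq_norm_sq, real_inner_comm d (h l l)]
        ring
      have e₁ := real_inner_le_norm (-G) d
      rw [norm_neg] at e₁
      have := hA.lower_Q d
      have := mul_nonneg hlam hQu
      linarith
    have h₂ : ‖G + Q (Q d)‖ ≤ (1 + C * c⁻¹) * ‖G‖ := by
      calc ‖G + Q (Q d)‖ ≤ ‖G‖ + C * (c⁻¹ * ‖G‖) :=
            (norm_add_le _ _).trans (by gcongr; exact (hA.bound_Q _).trans (by gcongr))
        _ = _ := by ring
    have h₃ : h l l = (G + Q (Q d)) + lam • Q (Q u) := by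
      rw [← hG]
      abel
    -- Pairing with `u`: `D_dd u` contributes `-‖D_d u‖²`, and `‖Q u‖²` controls `‖u‖²`.
    have h₄ : lam * ‖u‖ ≤ c⁻¹ * ‖G + Q (Q d)‖ := by
      have e := hu.inner_hess_self (k := l) (commutes_id _) (commutes_id _)
      simp only [ContinuousLinearMap.id_apply] at e
      have e₁ : ⟪-(G + Q (Q d)), u⟫ = ⟪g l, g l⟫ + lam * ‖Q u‖ ^ 2 := by
        have : -(G + Q (Q d)) = lam • Q (Q u) - h l l := by rw [h₃]; abel
        rw [this, inner_sub_left, real_inner_smul_left, hA.symm, real_inner_self_eq_norm_sq,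
          real_inner_comm u (h l l), e]
        ring
      have e₂ := real_inner_le_norm (-(G + Q (Q d))) u
      rw [norm_neg] at e₂
      have e₃ := mul_le_mul_of_nonneg_left (hA.lower_Q u) hlam
      have e₄ := real_inner_self_nonneg (x := g l)
      rcases (norm_nonneg u).eq_or_lt with h0 | h0
      · rw [← h0, mul_zero]
        positivity
      · rw [inv_mul_eq_div, le_div_iff₀ hc]
        refine le_of_mul_le_mul_right ?_ h0
        nlinarith
    have h₅ : ‖h l l‖ ≤ ‖G + Q (Q d)‖ + C * (lam * ‖u‖) := by
      rw [h₃]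
      refine (norm_add_le _ _).trans ?_
      rw [norm_smul, Real.norm_of_nonneg hlam]
      have := mul_le_mul_of_nonneg_left (hA.bound_Q u) hlam
      linarith
    have k₁ : c⁻¹ * (1 + C * c⁻¹) ≤ 2 * (1 + c⁻¹) * (1 + C * c⁻¹) ^ 2 := by
      nlinarith [mul_nonneg hi he, mul_nonneg (mul_nonneg hi he) he, mul_nonneg he he]
    have k₂ : (1 + C * c⁻¹) ^ 2 ≤ 2 * (1 + c⁻¹) * (1 + C * c⁻¹) ^ 2 := by
      nlinarith [mul_nonneg hi (sq_nonneg (1 + C * c⁻¹)), sq_nonneg (1 + C * c⁻¹)]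
    have k₃ : c⁻¹ ≤ 2 * (1 + c⁻¹) * (1 + C * c⁻¹) ^ 2 := by
      nlinarith [mul_nonneg hi he, mul_nonneg (mul_nonneg hi he) he, mul_nonneg he he]
    refine ⟨?_, h₁.trans (by gcongr), ?_⟩
    · calc ‖h l l‖ ≤ ‖G + Q (Q d)‖ + C * (c⁻¹ * ‖G + Q (Q d)‖) := h₅.trans (by gcongr)
        _ = (1 + C * c⁻¹) * ‖G + Q (Q d)‖ := by ring
        _ ≤ (1 + C * c⁻¹) * ((1 + C * c⁻¹) * ‖G‖) := by gcongr
        _ = (1 + C * c⁻¹) ^ 2 * ‖G‖ := by ring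
        _ ≤ _ := by gcongr
    · calc lam * ‖u‖ ≤ c⁻¹ * ((1 + C * c⁻¹) * ‖G‖) := h₄.trans (by gcongr)
        _ = c⁻¹ * (1 + C * c⁻¹) * ‖G‖ := by ring
        _ ≤ _ := by gcongr

end AbstractEstimates

/-! ### Combination of the estimates -/

section CombinedEstimate

variable {H : Type*} [NormedAddCommGroup H] [InnerProductSpace ℝ H] [CompleteSpace H] {n : ℕ}
variable {τ : ShiftSystem n H} {b : BoundaryKind} {u d : H} {g : Fin (n + 1) → H}
  {h : Fin (n + 1) → Fin (n + 1) → H}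
variable {c C : ℝ} {A : Fin (n + 1) → Fin (n + 1) → H →L[ℝ] H} {Q : H →L[ℝ] H}

theorem norm_double_sum_sub_le {m : ℕ} (I : Finset (Fin m)) (y : Fin m → Fin m → H) {B : ℝ}
    (hB : 0 ≤ B) (hy : ∀ i j, ¬(i ∈ I ∧ j ∈ I) → ‖y i j‖ ≤ B) :
    ‖∑ i, ∑ j, y i j - ∑ i ∈ I, ∑ j ∈ I, y i j‖ ≤ (m : ℝ) ^ 2 * B := by
  have e : ∑ i ∈ I, ∑ j ∈ I, y i j = ∑ i, ∑ j, if i ∈ I ∧ j ∈ I then y i j else 0 := by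
    simp only [ite_and, Finset.sum_ite_irrel, Finset.sum_const_zero, Finset.sum_ite_mem,
      Finset.univ_inter]
  rw [e]
  simp only [← Finset.sum_sub_distrib]
  calc _ ≤ ∑ _i : Fin m, ∑ _j : Fin m, B := by
        refine (norm_sum_le _ _).trans (Finset.sum_le_sum fun i _ => ?_)
        refine (norm_sum_le _ _).trans (Finset.sum_le_sum fun j _ => ?_)
        split_ifs with hij
        · simpa using hB
        · simpa using hy i j hij
    _ = (m : ℝ) ^ 2 * B := by
        simp
        ring

/-- The constant for the second derivatives other than the one in the last direction. -/
noncomputable def mixedConst (n : ℕ) (c C : ℝ) : ℝ :=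
  c⁻¹ * (1 + ((n + 1 : ℕ) : ℝ) ^ 2 * (C * c⁻¹))

/-- The constant of the a priori estimate. -/
noncomputable def estConst (n : ℕ) (c C : ℝ) : ℝ :=
  mixedConst n c C + 2 * (1 + c⁻¹) * (1 + C * c⁻¹) ^ 2 *
    (1 + ((n + 1 : ℕ) : ℝ) ^ 2 * (C * mixedConst n c C))

/-- Two stages, since only the first direction may carry a Neumann condition: the derivatives `D D_1
u` are bounded with all indices present, then the terms with an index 1, at most `(n + 1)²` of them,
are put on the right-hand side. -/
theorem InSpace.norm_mixed_le (hu : InSpace τ b u g h d) (hA : CoeffOps τ c C A Q) (hc : 0 < c)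
    (hC : 0 ≤ C) {lam : ℝ} (hlam : 0 ≤ lam) {F : H}
    (hF : -Q (Q d) + ∑ i, ∑ j, A i j (h i j) - lam • Q (Q u) = F) (i : Fin (n + 1))
    {k : Fin (n + 1)} (hk : k ≠ Fin.last n) : ‖h i k‖ ≤ mixedConst n c C * ‖F‖ := by
  have hi : 0 ≤ c⁻¹ := by positivity
  have h₁ : c⁻¹ ≤ mixedConst n c C := by
    rw [mixedConst]
    exact le_mul_of_one_le_right hi (le_add_of_nonneg_right (by positivity))
  have h₀ : (0 : Fin (n + 1)) ≠ Fin.last n := by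
    intro h
    have hn : n = 0 := by simpa using (congrArg Fin.val h).symm
    subst hn
    exact hk (Fin.ext (by omega))
  have hfirst : ∀ i, ‖h i 0‖ ≤ c⁻¹ * ‖F‖ := fun i =>
    hu.norm_hess_le hA hc h₀ (Finset.mem_univ 0) (fun j _ hj => hu.bc j hj) hlam hF
      (Finset.mem_univ i)
  by_cases hk0 : k = 0
  · subst hk0
    exact (hfirst i).trans (by gcongr)
  by_cases hi0 : i = 0
  · subst hi0
    rw [hu.hess_symm]
    exact (hfirst k).trans (by gcongr)
  have hmem : ∀ j : Fin (n + 1), j ≠ 0 → j ∈ Finset.univ.erase (0 : Fin (n + 1)) := fun j hj =>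
    Finset.mem_erase.2 ⟨hj, Finset.mem_univ _⟩
  have e := hu.norm_hess_le hA hc hk (hmem k hk0)
    (fun j hj _ => hu.bc j (Finset.ne_of_mem_erase hj)) hlam rfl (hmem i hi0)
  refine e.trans ?_
  rw [mixedConst, mul_assoc]
  gcongr
  have e₁ := norm_double_sum_sub_le (Finset.univ.erase (0 : Fin (n + 1)))
    (fun i j => A i j (h i j)) (B := C * (c⁻¹ * ‖F‖)) (by positivity) (by
      intro i j hij
      refine (hA.bound _ _ _).trans ?_
      gcongr
      by_cases hj : j = 0
      · rw [hj]
        exact hfirst i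
      by_cases hi : i = 0
      · rw [hi, hu.hess_symm]
        exact hfirst j
      · exact absurd ⟨hmem i hi, hmem j hj⟩ hij)
  refine (norm_le_norm_add_norm_sub F _).trans ?_
  rw [add_mul, one_mul]
  gcongr
  refine le_trans (le_of_eq (congrArg norm ?_)) (e₁.trans (le_of_eq (by ring)))
  rw [← hF]
  abel

theorem InSpace.norm_le (hu : InSpace τ b u g h d) (hA : CoeffOps τ c C A Q) (hc : 0 < c)
    (hC : 0 ≤ C) {lam : ℝ} (hlam : 0 ≤ lam) {F : H}
    (hF : -Q (Q d) + ∑ i, ∑ j, A i j (h i j) - lam • Q (Q u) = F) :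
    (∀ i j, ‖h i j‖ ≤ estConst n c C * ‖F‖) ∧ ‖d‖ ≤ estConst n c C * ‖F‖ ∧
    lam * ‖u‖ ≤ estConst n c C * ‖F‖ ∧ ∀ i, √lam * ‖g i‖ ≤ estConst n c C * ‖F‖ := by
  have hi : 0 ≤ c⁻¹ := by positivity
  have hM : 0 ≤ mixedConst n c C := by rw [mixedConst]; positivity
  have hmix := fun i {k : Fin (n + 1)} (hk : k ≠ Fin.last n) =>
    hu.norm_mixed_le hA hc hC hlam hF i hk
  have hmixed : ∀ i j, ¬(i = Fin.last n ∧ j = Fin.last n) → ‖h i j‖ ≤ mixedConst n c C * ‖F‖ := by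
    intro i j hij
    by_cases hj : j = Fin.last n
    · rw [hu.hess_symm]
      exact hmix j fun hi => hij ⟨hi, hj⟩
    · exact hmix i hj
  obtain ⟨e₁, e₂, e₃⟩ := hu.norm_last_le hA hc hC hlam rfl
  set G := -Q (Q d) + A (Fin.last n) (Fin.last n) (h (Fin.last n) (Fin.last n)) - lam • Q (Q u)
    with hG
  -- All second derivatives but `D_dd u` are now known, and `G` differs from `F` only by their
  -- terms.
  have hGF : ‖G‖ ≤ (1 + ((n + 1 : ℕ) : ℝ) ^ 2 * (C * mixedConst n c C)) * ‖F‖ := by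
    have e := norm_double_sum_sub_le {Fin.last n}
      (fun i j => A i j (h i j)) (B := C * (mixedConst n c C * ‖F‖)) (by positivity) (by
        intro i j hij
        refine (hA.bound _ _ _).trans ?_
        gcongr
        exact hmixed i j (by simpa using hij))
    refine (norm_le_norm_add_norm_sub F _).trans ?_
    rw [add_mul, one_mul]
    gcongr
    refine le_trans (le_of_eq (congrArg norm ?_)) (e.trans (le_of_eq (by ring)))
    rw [← hF, hG]
    simp only [Finset.sum_singleton]
    abel
  have hK : 0 ≤ 2 * (1 + c⁻¹) * (1 + C * c⁻¹) ^ 2 := by positivity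
  have hlast : ∀ x : ℝ, x ≤ 2 * (1 + c⁻¹) * (1 + C * c⁻¹) ^ 2 * ‖G‖ → x ≤ estConst n c C * ‖F‖ := by
    intro x hx
    refine hx.trans ?_
    rw [estConst, add_mul, mul_assoc _ (1 + _) ‖F‖]
    refine le_add_of_nonneg_of_le (by positivity) ?_
    gcongr
  have hh : ∀ i j, ‖h i j‖ ≤ estConst n c C * ‖F‖ := by
    intro i j
    by_cases hij : i = Fin.last n ∧ j = Fin.last n
    · rw [hij.1, hij.2]
      exact hlast _ e₁
    · refine (hmixed i j hij).trans ?_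
      rw [estConst]
      gcongr
      exact le_add_of_nonneg_right (by positivity)
  refine ⟨hh, hlast _ e₂, hlast _ e₃, fun i => ?_⟩
  have h₀ : 0 ≤ estConst n c C * ‖F‖ := (norm_nonneg _).trans (hlast _ e₂)
  refine le_of_sq_le_sq ?_ h₀
  rw [mul_pow, Real.sq_sqrt hlam]
  -- Interpolation: `‖D_i u‖² = -⟪u, D_ii u⟫`, so `λ ‖D_i u‖²` is at most `(λ ‖u‖) ‖D_ii u‖`.
  have e := hu.inner_hess_self (k := i) (commutes_id _) (commutes_id _)
  simp only [ContinuousLinearMap.id_apply, real_inner_self_eq_norm_sq] at e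
  have e' := real_inner_le_norm (-u) (h i i)
  rw [inner_neg_left, norm_neg, e, neg_neg] at e'
  calc lam * ‖g i‖ ^ 2 ≤ lam * (‖u‖ * ‖h i i‖) := by gcongr
    _ = (lam * ‖u‖) * ‖h i i‖ := by ring
    _ ≤ (estConst n c C * ‖F‖) * (estConst n c C * ‖F‖) :=
        mul_le_mul (hlast _ e₃) (hh i i) (norm_nonneg _) h₀
    _ = _ := by ring

end CombinedEstimate

/-! ### The translations of the wedge cylinder and the boundary conditions -/

section WedgeShifts

variable {n : ℕ} {T : WithTop ℝ} {k : ℕ}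

theorem isOpen_time (T : WithTop ℝ) : IsOpen {t : ℝ | (t : WithTop ℝ) < T} := by
  induction T with
  | top => simp
  | coe a =>
    simp only [WithTop.coe_lt_coe]
    exact isOpen_Iio

theorem isOpen_wedgeCylinder (n : ℕ) (T : WithTop ℝ) (k : ℕ) : IsOpen (wedgeCylinder n T k) := by
  have h : wedgeCylinder n T k = (Prod.fst ⁻¹' {t : ℝ | (t : WithTop ℝ) < T}) ∩
      ⋂ i : Fin (n + 1), {z : SpaceTime n | i.val < k → 0 < z.2 i} := by
    ext z
    simp [wedgeCylinder]
  rw [h]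
  refine ((isOpen_time T).preimage continuous_fst).inter (isOpen_iInter_of_finite fun i => ?_)
  by_cases hi : i.val < k
  · simp only [hi, true_imp_iff]
    exact isOpen_lt continuous_const ((continuous_apply i).comp continuous_snd)
  · simp [hi]

theorem time_lt_of_le {a b : ℝ} (h : (b : WithTop ℝ) < T) (hab : a ≤ b) : (a : WithTop ℝ) < T :=
  lt_of_le_of_lt (WithTop.coe_le_coe.2 hab) h

/-- The directions of the translations: backwards in time, and the spatial coordinate directions. -/
def direction (n : ℕ) : Option (Fin (n + 1)) → SpaceTime n
  | none => -timeDir n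
  | some i => spaceDir i

theorem add_smul_direction_mem (c : Option (Fin (n + 1))) (z : SpaceTime n)
    (hz : z ∈ wedgeCylinder n T k) (s : ℝ) (hs : 0 ≤ s) :
    z + s • direction n c ∈ wedgeCylinder n T k := by
  cases c with
  | none =>
    refine ⟨time_lt_of_le hz.1 (by simp [direction, timeDir, hs]), fun i hi => ?_⟩
    simpa [direction, timeDir] using hz.2 i hi
  | some j =>
    refine ⟨by simpa [direction, spaceDir] using hz.1, fun i hi => ?_⟩
    have h₁ := hz.2 i hi
    have h₂ : 0 ≤ (Pi.single j (1 : ℝ) : Fin (n + 1) → ℝ) i := by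
      by_cases hij : i = j
      · simp [hij]
      · simp [hij]
    simp only [direction, spaceDir, Prod.smul_mk, Prod.snd_add, Pi.add_apply, Pi.smul_apply,
      smul_eq_mul]
    positivity

/-- The cylinder is a product of conditions on single coordinates, so moves in different directions
do not interfere, whatever the signs of `s` and `r`. This makes the translations commute. -/
theorem mem_of_add_direction_mem {c c' : Option (Fin (n + 1))} (hc : c ≠ c') (s r : ℝ)
    (z : SpaceTime n) (hz : z ∈ wedgeCylinder n T k)
    (h : z + s • direction n c + r • direction n c' ∈ wedgeCylinder n T k) :
    z + s • direction n c ∈ wedgeCylinder n T k := by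
  cases c with
  | none =>
    obtain ⟨j, rfl⟩ := Option.ne_none_iff_exists'.1 hc.symm
    refine ⟨?_, fun i hi => ?_⟩
    · simpa [direction, timeDir, spaceDir] using h.1
    · simpa [direction, timeDir] using hz.2 i hi
  | some j =>
    refine ⟨by simpa [direction, spaceDir] using hz.1, fun i hi => ?_⟩
    have h₁ := hz.2 i hi
    have h₂ := h.2 i hi
    by_cases hij : i = j
    · subst hij
      cases c' with
      | none => simpa [direction, timeDir, spaceDir] using h₂
      | some l =>
        have hl : i ≠ l := fun e => hc (by rw [e])
        simpa [direction, spaceDir, hl] using h₂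
    · simpa [direction, spaceDir, hij] using h₁

theorem shift_direction_comm {c c' : Option (Fin (n + 1))} (hc : c ≠ c') (s r : ℝ)
    (x : L2 (wedgeCylinder n T k)) :
    shift _ (s • direction n c) (shift _ (r • direction n c') x) =
      shift _ (r • direction n c') (shift _ (s • direction n c) x) := by
  have hS := (isOpen_wedgeCylinder n T k).measurableSet
  rw [shift_shift hS (mem_of_add_direction_mem hc s r),
    shift_shift hS (mem_of_add_direction_mem hc.symm r s),
    add_comm (s • direction n c)]

/-- The translations of functions on the wedge cylinder. -/
noncomputable def wedgeShifts (n : ℕ) (T : WithTop ℝ) (k : ℕ) :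
    ShiftSystem n (L2 (wedgeCylinder n T k)) where
  T c := dirShift _ (direction n c)
  T' c := dirShift _ (-direction n c)
  pair c := shiftPair_dirShift (isOpen_wedgeCylinder n T k).measurableSet (add_smul_direction_mem c)
  cancel c := dirShift_cancel (isOpen_wedgeCylinder n T k).measurableSet (add_smul_direction_mem c)
  comm c c' hc s r x := shift_direction_comm hc s r x
  comm' c c' hc s r x := by
    have := shift_direction_comm hc s (-r) x
    simpa only [dirShift, smul_neg, neg_smul] using this
  contraction c s x := norm_shift_le (isOpen_wedgeCylinder n T k).measurableSet _ x

theorem isWeakDeriv_space_iff (i : Fin (n + 1)) {g h : L2 (wedgeCylinder n T k)} :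
    IsWeakDeriv (spaceDir i) g h ↔ Gen ((wedgeShifts n T k).T (some i)) g h :=
  isWeakDeriv_iff (isOpen_wedgeCylinder n T k) (add_smul_direction_mem (some i))

theorem isWeakDeriv_time_iff {g h : L2 (wedgeCylinder n T k)} :
    IsWeakDeriv (timeDir n) g h ↔ Gen ((wedgeShifts n T k).T none) g (-h) := by
  rw [← isWeakDeriv_neg]
  exact isWeakDeriv_iff (isOpen_wedgeCylinder n T k) (add_smul_direction_mem none)

/-- There is no wall in such a direction, so both translations preserve the cylinder and the weak
derivative formally satisfies a Dirichlet condition. Free directions thus need no separate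
treatment. -/
theorem isWeakDeriv_free_iff {i : Fin (n + 1)} (hi : ¬ i.val < k)
    {g h : L2 (wedgeCylinder n T k)} :
    IsWeakDeriv (spaceDir i) g h ↔ Gen ((wedgeShifts n T k).T' (some i)) g (-h) := by
  rw [← isWeakDeriv_neg]
  refine isWeakDeriv_iff (isOpen_wedgeCylinder n T k) fun z hz s _ => ⟨?_, fun j hj => ?_⟩
  · simpa [spaceDir] using hz.1
  · have hij : j ≠ i := fun e => hi (e ▸ hj)
    simpa [spaceDir, hij] using hz.2 j hj

/-- The test functions for the trace may cross the face `x_i = 0`. They include the translates of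
test functions of the cylinder towards that face, and their restrictions lie in the domain of the
generator of inward translations, so adjointness gives the converse. -/
theorem isTrace_zero_iff (i : Fin (n + 1)) {g h : L2 (wedgeCylinder n T k)} :
    IsTrace i g h 0 ↔ Gen ((wedgeShifts n T k).T' (some i)) g (-h) := by
  have hS := isOpen_wedgeCylinder n T k
  have hp := (wedgeShifts n T k).pair (some i)
  have hface : ∀ φ : SpaceTime n → ℝ, -∫ y in lateralFace n T k i,
      (0 : L2 (lateralFace n T k i)) y * φ (y.1, i.insertNth 0 y.2) = 0 := fun φ => by
    rw [neg_eq_zero]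
    refine integral_eq_zero_of_ae ?_
    filter_upwards [Lp.coeFn_zero ℝ 2 (volume.restrict (lateralFace n T k i))] with y hy
    exact mul_eq_zero_of_left hy _
  have hsplit : ∀ φ : SpaceTime n → ℝ, ContDiff ℝ ∞ φ → HasCompactSupport φ →
      ∫ z in wedgeCylinder n T k, (g z * fderiv ℝ φ z (spaceDir i) + h z * φ z) =
      (∫ z in wedgeCylinder n T k, g z * fderiv ℝ φ z (spaceDir i)) +
        ∫ z in wedgeCylinder n T k, h z * φ z := fun φ h₁ h₂ =>
    integral_add
      ((Lp.memLp g).integrable_mul (memLp_of_smooth (smooth_fderiv_apply h₁ _)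
        (hasCompactSupport_fderiv_apply h₂ _) _))
      ((Lp.memLp h).integrable_mul (memLp_of_smooth h₁ h₂ _))
  refine ⟨fun H => ?_, fun H φ hφ => ?_⟩
  · refine gen_of_test hS (by rw [neg_neg]; exact hp.symm) fun φ hφ s hs => ?_
    have hφ' := hφ.comp_sub (w := s • -spaceDir i)
      (B := {z | (z.1 : WithTop ℝ) < T ∧ ∀ j : Fin (n + 1), j.val < k → j ≠ i → 0 < z.2 j}) (by
        rintro z hz
        refine ⟨by simpa [spaceDir] using hz.1, fun j hj hji => ?_⟩
        simpa [spaceDir, hji] using hz.2 j hj)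
    have e := H _ hφ'
    rw [hface fun z => φ (z - s • -spaceDir i), hsplit _ hφ'.smooth hφ'.compact] at e
    simp only [fderiv_comp_sub_apply] at e
    have e₁ : ∫ z in wedgeCylinder n T k, (-h) z * φ (z - s • -spaceDir i) =
        -∫ z in wedgeCylinder n T k, h z * φ (z - s • -spaceDir i) := by
      rw [← integral_neg]
      refine integral_congr_ae ?_
      filter_upwards [Lp.coeFn_neg h] with z hz
      rw [hz]
      simp
    simp only [direction] at *
    rw [e₁]
    simp only [map_neg, mul_neg, integral_neg, neg_neg]
    linarith
  · have e := (gen_of_smooth hS (add_smul_direction_mem (some i)) hφ.smooth hφ.compact).adjoint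
      hp H
    rw [inner_smooth, inner_neg_left, inner_smooth] at e
    rw [hface, hsplit _ hφ.smooth hφ.compact]
    exact (eq_neg_iff_add_eq_zero).1 e

theorem W12.inSpace {b : BoundaryKind} (u : W12 n T k) (hu : u.BoundaryCondition b) :
    InSpace (wedgeShifts n T k) b u.val u.grad u.hess u.dt where
  grad i := (isWeakDeriv_space_iff i).1 (u.grad_weak i)
  hess i j := (isWeakDeriv_space_iff j).1 (u.hess_weak i j)
  time := isWeakDeriv_time_iff.1 u.dt_weak
  bc_first := by
    have h := hu.1
    cases b
    · exact (isTrace_zero_iff 0).1 h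
    · exact (isTrace_zero_iff 0).1 h
  bc i hi := by
    by_cases hik : i.val < k
    · exact (isTrace_zero_iff i).1 (hu.2 i hi hik)
    · exact (isWeakDeriv_free_iff hik).1 (u.grad_weak i)

theorem InSpace.exists_W12 {b : BoundaryKind} {u d : L2 (wedgeCylinder n T k)}
    {g : Fin (n + 1) → L2 (wedgeCylinder n T k)}
    {h : Fin (n + 1) → Fin (n + 1) → L2 (wedgeCylinder n T k)}
    (hu : InSpace (wedgeShifts n T k) b u g h d) :
    ∃ w : W12 n T k, w.val = u ∧ w.grad = g ∧ w.hess = h ∧ w.dt = d ∧ w.BoundaryCondition b := by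
  refine ⟨⟨u, g, h, d, fun i => (isWeakDeriv_space_iff i).2 (hu.grad i),
    fun i j => (isWeakDeriv_space_iff j).2 (hu.hess i j), isWeakDeriv_time_iff.2 hu.time⟩,
    rfl, rfl, rfl, rfl, ?_, fun i hi _ => (isTrace_zero_iff i).2 (hu.bc i hi)⟩
  have e := hu.bc_first
  cases b
  · exact (isTrace_zero_iff 0).2 e
  · exact (isTrace_zero_iff 0).2 e

end WedgeShifts

/-! ### Coefficients as operators and the a priori estimate -/

section Coefficients

variable {n : ℕ} {T : WithTop ℝ} {k : ℕ} {δ : ℝ}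
  {a : Fin (n + 1) → Fin (n + 1) → ℝ → ℝ → ℝ}

/-- The coefficient `a^{ij}(t, x_d)` as a function on space-time. -/
def coeffFun (a : Fin (n + 1) → Fin (n + 1) → ℝ → ℝ → ℝ) (i j : Fin (n + 1)) (z : SpaceTime n) : ℝ :=
  a i j z.1 (z.2 (Fin.last n))

theorem AdmissibleCoeff.aemeasurable (ha : AdmissibleCoeff δ a) (i j : Fin (n + 1)) :
    AEMeasurable (coeffFun a i j) volume := by
  have hq : Measure.QuasiMeasurePreserving
      (Prod.map id (Function.eval (Fin.last n)) : SpaceTime n → ℝ × ℝ) volume volume :=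
    MeasureTheory.QuasiMeasurePreserving.prodMap (Measure.QuasiMeasurePreserving.id volume)
      (Measure.quasiMeasurePreserving_eval (fun _ => volume) (Fin.last n))
  exact (ha.meas i j).comp_quasiMeasurePreserving hq

theorem AdmissibleCoeff.memLp (ha : AdmissibleCoeff δ a) (S : Set (SpaceTime n))
    (i j : Fin (n + 1)) : MemLp (coeffFun a i j) ⊤ (volume.restrict S) :=
  memLp_top_of_bound (ha.aemeasurable i j).restrict.aestronglyMeasurable δ⁻¹
    (ae_of_all _ fun _ => ha.bounded i j _ _)

theorem AdmissibleCoeff.le_diag (ha : AdmissibleCoeff δ a) (i : Fin (n + 1)) (t s : ℝ) :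
    δ ≤ a i i t s := by
  have h := ha.elliptic t s (Pi.single i 1)
  simpa [Pi.single_apply] using h

/-- Multiplication by the coefficient `a^{ij}`. -/
noncomputable def coeffOp (ha : AdmissibleCoeff δ a) (S : Set (SpaceTime n)) (i j : Fin (n + 1)) :
    L2 S →L[ℝ] L2 S :=
  mulL2 (ha.memLp S i j)

theorem sum_inner_mulL2_ge {S : Set (SpaceTime n)} {m : ℕ} {B : Fin m → Fin m → SpaceTime n → ℝ}
    (hB : ∀ i j, MemLp (B i j) ⊤ (volume.restrict S)) {c : ℝ}
    (h : ∀ z (ξ : Fin m → ℝ), c * ∑ i, ξ i ^ 2 ≤ ∑ i, ∑ j, B i j z * ξ i * ξ j)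
    (x : Fin m → L2 S) : c * ∑ i, ‖x i‖ ^ 2 ≤ ∑ i, ∑ j, ⟪mulL2 (hB i j) (x i), x j⟫ := by
  have hint : ∀ f g : L2 S, Integrable (fun z => f z * g z) (volume.restrict S) := fun f g =>
    (Lp.memLp f).integrable_mul (Lp.memLp g)
  simp only [← real_inner_self_eq_norm_sq, inner_L2]
  rw [← integral_finsetSum _ fun i _ => hint _ _, ← integral_const_mul]
  simp_rw [← integral_finsetSum (Finset.univ : Finset (Fin m)) fun j _ => hint _ _]
  rw [← integral_finsetSum _ fun i _ => integrable_finsetSum _ fun j _ => hint _ _]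
  refine integral_mono_ae ((integrable_finsetSum _ fun i _ => hint _ _).const_mul c)
    (integrable_finsetSum _ fun i _ => integrable_finsetSum _ fun j _ => hint _ _) ?_
  have hae : ∀ᵐ z ∂(volume.restrict S), ∀ i j, mulL2 (hB i j) (x i) z = B i j z * x i z :=
    ae_all_iff.2 fun i => ae_all_iff.2 fun j => mulL2_coe (hB i j) (x i)
  filter_upwards [hae] with z hz
  have := h z fun i => x i z
  simpa only [hz, sq] using this

theorem commutes_mulL2 {b : SpaceTime n → ℝ}
    (hb : MemLp b ⊤ (volume.restrict (wedgeCylinder n T k))) {c : Option (Fin (n + 1))}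
    (h : ∀ z (s : ℝ), b (z + s • direction n c) = b z) :
    Commutes (mulL2 hb) ((wedgeShifts n T k).T c) ∧
      Commutes (mulL2 hb) ((wedgeShifts n T k).T' c) := by
  have hS := (isOpen_wedgeCylinder n T k).measurableSet
  refine ⟨fun s x => mulL2_shift hS hb (fun z => h z s) x,
    fun s x => mulL2_shift hS hb (fun z => ?_) x⟩
  rw [smul_neg, ← neg_smul]
  exact h z (-s)

/-- Since `q²` lies between `δ` and `δ⁻¹`, multiplication by it changes the ellipticity constant to
`δ²` and the bound to `δ⁻²`. As `q` depends on `x_d` only, it commutes with translations in time and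
in the other spatial directions. The weight is kept as a square to exhibit energies as squared norms
of `Q u`. -/
theorem coeffOps_of_weight (hδ0 : 0 < δ) (hδ1 : δ < 1) (ha : AdmissibleCoeff δ a)
    {q : ℝ → ℝ} (hqm : AEMeasurable (fun z : SpaceTime n => q (z.2 (Fin.last n))) volume)
    (hq : ∀ s, δ ≤ q s ^ 2 ∧ q s ^ 2 ≤ δ⁻¹) 
    (hlast : (∃ α : ℝ → ℝ, ∀ t s, q s ^ 2 * a (Fin.last n) (Fin.last n) t s = α t))
    (hor : (∀ s, q s = 1) ∨ ∀ t s, q s ^ 2 * a (Fin.last n) (Fin.last n) t s = 1) :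
    ∃ (A : Fin (n + 1) → Fin (n + 1) →
        L2 (wedgeCylinder n T k) →L[ℝ] L2 (wedgeCylinder n T k))
      (Q : L2 (wedgeCylinder n T k) →L[ℝ] L2 (wedgeCylinder n T k)),
      CoeffOps (wedgeShifts n T k) (δ ^ 2) (δ ^ 2)⁻¹ A Q ∧
      ∀ i j x, A i j x = Q (Q (coeffOp ha _ i j x)) := by
  set S := wedgeCylinder n T k
  have hδi : 1 ≤ δ⁻¹ := (one_le_inv₀ hδ0).2 hδ1.le
  have hqb : ∀ s, |q s| ≤ δ⁻¹ := fun s => by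
    refine abs_le_of_sq_le_sq ((hq s).2.trans ?_) (by positivity)
    nlinarith
  have hqL : MemLp (fun z : SpaceTime n => q (z.2 (Fin.last n))) ⊤ (volume.restrict S) :=
    memLp_top_of_bound hqm.restrict.aestronglyMeasurable δ⁻¹ (ae_of_all _ fun z => hqb _)
  let B : Fin (n + 1) → Fin (n + 1) → SpaceTime n → ℝ := fun i j z =>
    q (z.2 (Fin.last n)) ^ 2 * coeffFun a i j z
  have hBb : ∀ i j z, |B i j z| ≤ (δ ^ 2)⁻¹ := fun i j z => by
    simp only [B]
    rw [abs_mul, abs_of_nonneg (sq_nonneg _), sq δ, mul_inv]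
    exact mul_le_mul (hq _).2 (ha.bounded i j _ _) (abs_nonneg _) (by positivity)
  have hBL : ∀ i j, MemLp (B i j) ⊤ (volume.restrict S) := fun i j =>
    memLp_top_of_bound
      ((hqm.pow_const 2).mul (ha.aemeasurable i j)).restrict.aestronglyMeasurable (δ ^ 2)⁻¹
      (ae_of_all _ fun z => hBb i j z)
  have hQQ : ∀ x : L2 S, mulL2 hqL (mulL2 hqL x)
      =ᵐ[volume.restrict S] fun z => q (z.2 (Fin.last n)) ^ 2 * x z := fun x => by
    filter_upwards [mulL2_coe hqL x, mulL2_coe hqL (mulL2 hqL x)] with z h₁ h₂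
    rw [h₂, h₁]
    ring
  have hdir : ∀ i, i ≠ Fin.last n → ∀ (z : SpaceTime n) (s : ℝ),
      (z + s • direction n (some i)).1 = z.1 ∧
      (z + s • direction n (some i)).2 (Fin.last n) = z.2 (Fin.last n) := fun i hi z s => by
    simp [direction, spaceDir, hi.symm]
  have hcB : ∀ i j l, l ≠ Fin.last n → _ := fun i j l hl =>
    commutes_mulL2 (c := some l) (hBL i j) fun z s => by
      simp only [B, coeffFun, (hdir l hl z s).1, (hdir l hl z s).2]
  have hcQ : ∀ l, l ≠ Fin.last n → _ := fun l hl =>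
    commutes_mulL2 (c := some l) hqL fun z s => by
      simp only [(hdir l hl z s).2]
  refine ⟨fun i j => mulL2 (hBL i j), mulL2 hqL, ⟨fun i j l hl => (hcB i j l hl).1,
    fun i j l hl => (hcB i j l hl).2, ?_, fun i j => mulL2_adjoint _, mulL2_adjoint _, ?_,
    fun l hl => (hcQ l hl).1, fun l hl => (hcQ l hl).2, ?_, fun i j => norm_mulL2_le _ (hBb i j),
    ?_, ?_, ?_⟩, ?_⟩
  · obtain ⟨α, hα⟩ := hlast
    refine (commutes_mulL2 (c := some (Fin.last n)) _ fun z s => ?_).1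
    simp only [B, coeffFun, hα]
    simp [direction, spaceDir]
  · refine (commutes_mulL2 (c := none) _ fun z s => ?_).1
    simp [direction, timeDir]
  · refine sum_inner_mulL2_ge hBL fun z ξ => ?_
    have h₁ := ha.elliptic z.1 (z.2 (Fin.last n)) ξ
    have h₂ := (hq (z.2 (Fin.last n))).1
    have h₃ : 0 ≤ ∑ i, ξ i ^ 2 := Finset.sum_nonneg fun _ _ => sq_nonneg _
    calc δ ^ 2 * ∑ i, ξ i ^ 2 = δ * (δ * ∑ i, ξ i ^ 2) := by ring
      _ ≤ q (z.2 (Fin.last n)) ^ 2 * (δ * ∑ i, ξ i ^ 2) := by gcongr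
      _ ≤ q (z.2 (Fin.last n)) ^ 2 *
          ∑ i, ∑ j, a i j z.1 (z.2 (Fin.last n)) * ξ i * ξ j := by gcongr
      _ = _ := by simp only [B, coeffFun, Finset.mul_sum, mul_assoc]
  · intro x
    have e := sum_inner_mulL2_ge (m := 1) (B := fun _ _ z => q (z.2 (Fin.last n)) ^ 2)
      (c := δ ^ 2) (S := S) (fun _ _ => memLp_top_of_bound
        (hqm.pow_const 2).restrict.aestronglyMeasurable δ⁻¹ (ae_of_all _ fun z => by
          rw [Real.norm_of_nonneg (sq_nonneg _)]
          exact (hq _).2)) (fun z ξ => by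
        simp only [Finset.univ_unique, Finset.sum_singleton]
        have h₂ := (hq (z.2 (Fin.last n))).1
        have h₃ : δ ^ 2 ≤ δ := by nlinarith
        nlinarith [sq_nonneg (ξ default), mul_le_mul_of_nonneg_right (h₃.trans h₂)
          (sq_nonneg (ξ default))]) fun _ => x
    simp only [Finset.univ_unique, Finset.sum_singleton] at e
    refine e.trans (le_of_eq ?_)
    rw [← real_inner_self_eq_norm_sq, mulL2_adjoint hqL, real_inner_comm]
    congr 1
    refine Lp.ext ?_
    filter_upwards [hQQ x, mulL2_coe (memLp_top_of_bound (μ := volume.restrict S)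
        (hqm.pow_const 2).restrict.aestronglyMeasurable δ⁻¹ (ae_of_all _ fun z => by
          rw [Real.norm_of_nonneg (sq_nonneg _)]
          exact (hq _).2)) x] with z h₁ h₂
    rw [h₁, h₂]
  · intro x
    calc _ ≤ δ⁻¹ * (δ⁻¹ * ‖x‖) := (norm_mulL2_le _ (fun _ => hqb _) _).trans (by
          gcongr
          exact norm_mulL2_le _ (fun _ => hqb _) _)
      _ = _ := by rw [sq δ, mul_inv, mul_assoc]
  · refine hor.imp (fun h x => Lp.ext ?_) (fun h x => Lp.ext ?_)
    · filter_upwards [mulL2_coe hqL x] with z hz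
      rw [hz, h, one_mul]
    · filter_upwards [mulL2_coe (hBL (Fin.last n) (Fin.last n)) x] with z hz
      rw [hz]
      simp only [B, coeffFun, h, one_mul]
  · intro i j x
    refine Lp.ext ?_
    filter_upwards [mulL2_coe (hBL i j) x, hQQ (coeffOp ha S i j x), mulL2_coe (ha.memLp S i j) x]
      with z h₁ h₂ h₃
    rw [h₁, h₂, coeffOp, h₃]
    ring

theorem exists_coeffOps (hδ0 : 0 < δ) (hδ1 : δ < 1) (ha : AdmissibleCoeff δ a) :
    ∃ (A : Fin (n + 1) → Fin (n + 1) →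
        L2 (wedgeCylinder n T k) →L[ℝ] L2 (wedgeCylinder n T k))
      (Q : L2 (wedgeCylinder n T k) →L[ℝ] L2 (wedgeCylinder n T k)),
      CoeffOps (wedgeShifts n T k) (δ ^ 2) (δ ^ 2)⁻¹ A Q ∧
      ∀ i j x, A i j x = Q (Q (coeffOp ha _ i j x)) := by
  rcases ha.last with ⟨α, _, hα⟩ | ⟨α, hm, hα⟩
  · refine coeffOps_of_weight (q := fun _ => 1) hδ0 hδ1 ha aemeasurable_const (fun s => ?_)
      ⟨α, fun t s => by rw [hα]; ring⟩ (.inl fun s => rfl)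
    simpa using ⟨hδ1.le, (one_le_inv₀ hδ0).2 hδ1.le⟩
  · have hpos : ∀ s, 0 < α s := fun s => by
      rw [← hα 0 s]
      exact hδ0.trans_le (ha.le_diag _ _ _)
    have hsq : ∀ s, √(α s)⁻¹ ^ 2 = (α s)⁻¹ := fun s => Real.sq_sqrt (inv_nonneg.2 (hpos s).le)
    have h1 : ∀ t s, √(α s)⁻¹ ^ 2 * a (Fin.last n) (Fin.last n) t s = 1 := fun t s => by
      rw [hsq, hα, inv_mul_cancel₀ (hpos s).ne']
    -- Dividing by `α(x_d)` makes the last coefficient one.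
    refine coeffOps_of_weight (q := fun s => √(α s)⁻¹) hδ0 hδ1 ha ?_ (fun s => ?_)
      ⟨fun _ => 1, h1⟩ (.inr h1)
    · refine (Real.continuous_sqrt.measurable.comp_aemeasurable ?_)
      have e : (fun z : SpaceTime n => (α (z.2 (Fin.last n)))⁻¹) =
          fun z => (coeffFun a (Fin.last n) (Fin.last n) z)⁻¹ := by
        ext z
        rw [coeffFun, hα]
      rw [e]
      exact (ha.aemeasurable _ _).inv
    · rw [hsq]
      have h₁ := ha.bounded (Fin.last n) (Fin.last n) 0 s
      have h₂ := ha.le_diag (Fin.last n) 0 s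
      rw [hα] at h₁ h₂
      refine ⟨?_, inv_anti₀ hδ0 h₂⟩
      have h₃ := inv_anti₀ (hpos s) ((le_abs_self _).trans h₁)
      rwa [inv_inv] at h₃

/-- The constant of the a priori estimate for coefficients with ellipticity constant `δ`. -/
noncomputable def aprioriConst (n : ℕ) (δ : ℝ) : ℝ :=
  estConst n (δ ^ 2) (δ ^ 2)⁻¹ * (δ ^ 2)⁻¹

theorem aprioriConst_pos (n : ℕ) (hδ0 : 0 < δ) : 0 < aprioriConst n δ := by
  rw [aprioriConst, estConst, mixedConst]
  positivity

theorem InSpace.apriori (hδ0 : 0 < δ) (hδ1 : δ < 1) (ha : AdmissibleCoeff δ a)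
    {b : BoundaryKind} {u d f : L2 (wedgeCylinder n T k)}
    {g : Fin (n + 1) → L2 (wedgeCylinder n T k)}
    {h : Fin (n + 1) → Fin (n + 1) → L2 (wedgeCylinder n T k)}
    (hu : InSpace (wedgeShifts n T k) b u g h d) {lam : ℝ} (hlam : 0 ≤ lam)
    (hf : -d + ∑ i, ∑ j, coeffOp ha _ i j (h i j) - lam • u = f) :
    (∀ i j, ‖h i j‖ ≤ aprioriConst n δ * ‖f‖) ∧ ‖d‖ ≤ aprioriConst n δ * ‖f‖ ∧
    lam * ‖u‖ ≤ aprioriConst n δ * ‖f‖ ∧ ∀ i, √lam * ‖g i‖ ≤ aprioriConst n δ * ‖f‖ := by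
  obtain ⟨A, Q, hA, hAQ⟩ := exists_coeffOps (T := T) (k := k) hδ0 hδ1 ha
  -- The weighted equation is `Q²` applied to the original one; the additional factor `(δ ^ 2)⁻¹` in
  -- `aprioriConst` bounds `Q² f`.
  have hF : -Q (Q d) + ∑ i, ∑ j, A i j (h i j) - lam • Q (Q u) = Q (Q f) := by
    rw [← hf]
    simp only [map_sub, map_add, map_neg, map_sum, map_smul, hAQ]
  obtain ⟨e₁, e₂, e₃, e₄⟩ := hu.norm_le hA (by positivity) (by positivity) hlam hF
  have hM : 0 ≤ estConst n (δ ^ 2) (δ ^ 2)⁻¹ := by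
    rw [estConst, mixedConst]
    positivity
  have hle : estConst n (δ ^ 2) (δ ^ 2)⁻¹ * ‖Q (Q f)‖ ≤ aprioriConst n δ * ‖f‖ := by
    rw [aprioriConst, mul_assoc]
    gcongr
    exact hA.bound_Q f
  exact ⟨fun i j => (e₁ i j).trans hle, e₂.trans hle, e₃.trans hle, fun i => (e₄ i).trans hle⟩

theorem W12.solves_iff (ha : AdmissibleCoeff δ a) (u : W12 n T k) (lam : ℝ)
    (f : L2 (wedgeCylinder n T k)) :
    u.Solves a lam f ↔
      -u.dt + ∑ i, ∑ j, coeffOp ha _ i j (u.hess i j) - lam • u.val = f := by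
  have hsum : ∀ {m : ℕ} (x : Fin m → L2 (wedgeCylinder n T k)),
      (∑ i, x i : L2 (wedgeCylinder n T k)) =ᵐ[volume.restrict (wedgeCylinder n T k)]
        fun z => ∑ i, x i z := fun x => by
    filter_upwards [Lp.coeFn_finsetSum Finset.univ x] with z hz
    rw [hz, Finset.sum_apply]
  have h : (-u.dt + ∑ i, ∑ j, coeffOp ha _ i j (u.hess i j) - lam • u.val :
      L2 (wedgeCylinder n T k)) =ᵐ[volume.restrict (wedgeCylinder n T k)] fun z =>
      -(u.dt z) + ∑ i, ∑ j, a i j z.1 (z.2 (Fin.last n)) * u.hess i j z - lam * u.val z := by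
    have h₁ : ∀ᵐ z ∂(volume.restrict (wedgeCylinder n T k)), ∀ i j,
        coeffOp ha _ i j (u.hess i j) z = coeffFun a i j z * u.hess i j z :=
      ae_all_iff.2 fun i => ae_all_iff.2 fun j => mulL2_coe (ha.memLp _ i j) _
    have h₂ : ∀ᵐ z ∂(volume.restrict (wedgeCylinder n T k)), ∀ i,
        (∑ j, coeffOp ha _ i j (u.hess i j) : L2 (wedgeCylinder n T k)) z =
          ∑ j, coeffOp ha _ i j (u.hess i j) z := ae_all_iff.2 fun i => hsum _
    filter_upwards [h₁, h₂, hsum fun i => ∑ j, coeffOp ha _ i j (u.hess i j),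
      Lp.coeFn_sub (-u.dt + ∑ i, ∑ j, coeffOp ha _ i j (u.hess i j)) (lam • u.val),
      Lp.coeFn_add (-u.dt) (∑ i, ∑ j, coeffOp ha _ i j (u.hess i j)), Lp.coeFn_neg u.dt,
      Lp.coeFn_smul lam u.val] with z h₁ h₂ h₃ h₄ h₅ h₆ h₇
    rw [h₄, Pi.sub_apply, h₅, Pi.add_apply, h₆, Pi.neg_apply, h₇, Pi.smul_apply, h₃, smul_eq_mul]
    simp only [h₂, h₁, coeffFun]
  refine ⟨fun H => Lp.ext ?_, fun H => ?_⟩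
  · filter_upwards [h, H] with z h₁ h₂
    rw [h₁, h₂]
  · filter_upwards [h] with z h₁
    rw [← h₁, H]

theorem sqrt_sum_sq_le {m : ℕ} {x : Fin m → ℝ} {M : ℝ} (hM : 0 ≤ M) (h₀ : ∀ i, 0 ≤ x i)
    (h : ∀ i, x i ≤ M) : √(∑ i, x i ^ 2) ≤ m * M := by
  refine Real.sqrt_le_iff.2 ⟨by positivity, ?_⟩
  calc ∑ i, x i ^ 2 ≤ (∑ i, x i) ^ 2 := Finset.sum_sq_le_sq_sum_of_nonneg fun i _ => h₀ i
    _ ≤ (∑ _i : Fin m, M) ^ 2 := by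
        gcongr with i
        · exact Finset.sum_nonneg fun i _ => h₀ i
        · exact h i
    _ = (m * M) ^ 2 := by simp

theorem W12.estimate (hδ0 : 0 < δ) (hδ1 : δ < 1) (ha : AdmissibleCoeff δ a) {b : BoundaryKind}
    {u : W12 n T k} {f : L2 (wedgeCylinder n T k)} {lam : ℝ} (hlam : 0 ≤ lam)
    (hu : u.BoundaryCondition b) (hf : u.Solves a lam f) :
    lam * ‖u.val‖ + √lam * u.gradNorm + u.hessNorm + ‖u.dt‖ ≤
      (2 + ((n + 1 : ℕ) : ℝ) + ((n + 1 : ℕ) : ℝ) ^ 2) * aprioriConst n δ * ‖f‖ := by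
  obtain ⟨e₁, e₂, e₃, e₄⟩ :=
    (u.inSpace hu).apriori hδ0 hδ1 ha hlam ((u.solves_iff ha lam f).1 hf)
  have hM : 0 ≤ aprioriConst n δ * ‖f‖ := (norm_nonneg _).trans e₂
  have h₁ : √lam * u.gradNorm ≤ ((n + 1 : ℕ) : ℝ) * (aprioriConst n δ * ‖f‖) := by
    have := sqrt_sum_sq_le (x := fun i => √lam * ‖u.grad i‖) hM (fun i => by positivity) e₄
    refine le_trans (le_of_eq ?_) this
    simp only [mul_pow, Real.sq_sqrt hlam, ← Finset.mul_sum]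
    rw [Real.sqrt_mul hlam, W12.gradNorm]
  have h₂ : u.hessNorm ≤ ((n + 1 : ℕ) : ℝ) * (((n + 1 : ℕ) : ℝ) * (aprioriConst n δ * ‖f‖)) := by
    have := sqrt_sum_sq_le (x := fun i => √(∑ j, ‖u.hess i j‖ ^ 2))
      (M := ((n + 1 : ℕ) : ℝ) * (aprioriConst n δ * ‖f‖)) (by positivity)
      (fun i => Real.sqrt_nonneg _) (fun i => sqrt_sum_sq_le hM (fun j => norm_nonneg _) (e₁ i))
    refine le_trans (le_of_eq ?_) this
    rw [W12.hessNorm]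
    congr 1
    refine Finset.sum_congr rfl fun i _ => ?_
    rw [Real.sq_sqrt (Finset.sum_nonneg fun j _ => sq_nonneg _)]
  -- The four terms contribute the factors 1, `n + 1`, `(n + 1)²` and 1.
  nlinarith

end Coefficients

/-! ### One-dimensional resolvents and smoothing -/

section Resolvents

variable {H : Type*} [NormedAddCommGroup H] [InnerProductSpace ℝ H] [CompleteSpace H] {n : ℕ}

/-- `J = (1 - D_i²)⁻¹` with the boundary condition in the direction `i`, and `D = D_i J`. -/
structure IsResolvent (τ : ShiftSystem n H) (b : BoundaryKind) (i : Fin (n + 1))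
    (J D : H →L[ℝ] H) : Prop where
  grad : ∀ f, Gen (τ.T (some i)) (J f) (D f)
  hess : ∀ f, Gen (τ.T (some i)) (D f) (J f - f)
  bc : (i = 0 → b = .dirichlet) → ∀ f, Gen (τ.T' (some i)) (J f) (-D f)
  bc_neumann : i = 0 → b = .neumann → ∀ f, Gen (τ.T' (some i)) (D f) (-(J f - f))
  comm : ∀ B : H →L[ℝ] H, Commutes B (τ.T (some i)) → Commutes B (τ.T' (some i)) →
    Commute B J ∧ Commute B D
  symm : ∀ x y, ⟪J x, y⟫ = ⟪x, J y⟫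
  injective : ∀ x, J x = 0 → x = 0

/-- Uniqueness in `Gen.eq_zero_of_resolvent` gives commutation: `B J f` and `J B f` solve the same
problem. Symmetry is adjointness used twice. -/
theorem resolvent_properties {V W : ℝ → H →L[ℝ] H} (h : ShiftPair V W) {J K : H →L[ℝ] H}
    (hJ : ∀ f, Gen V (J f) (K f) ∧ Gen W (K f) (f - J f)) :
    (∀ B : H →L[ℝ] H, Commutes B V → Commutes B W → Commute B J ∧ Commute B K) ∧
    (∀ x y, ⟪J x, y⟫ = ⟪x, J y⟫) ∧ ∀ x, J x = 0 → x = 0 := by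
  refine ⟨fun B hV hW => ?_, fun x y => ?_, fun x hx => ?_⟩
  · have key : ∀ f, B (J f) - J (B f) = 0 ∧ B (K f) - K (B f) = 0 := fun f => by
      refine Gen.eq_zero_of_resolvent h
        (((hJ f).1.map h B hV).sub h (hJ (B f)).1) ?_
      have e := ((hJ f).2.map h.symm B hW).sub h.symm (hJ (B f)).2
      convert! e using 1
      rw [map_sub]
      abel
    exact ⟨ContinuousLinearMap.ext fun f => sub_eq_zero.1 (key f).1,
      ContinuousLinearMap.ext fun f => sub_eq_zero.1 (key f).2⟩
  · have e₁ := (hJ x).1.adjoint h (hJ y).2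
    have e₂ := (hJ y).1.adjoint h (hJ x).2
    rw [inner_sub_left] at e₁ e₂
    have e₃ := real_inner_comm (K x) (K y)
    have e₄ := real_inner_comm (J x) (J y)
    rw [real_inner_comm]
    linarith
  · have e : K x = 0 := (hJ x).1.unique h (by rw [hx]; exact Gen.zero)
    have e' := (hJ x).2
    rw [hx, e, sub_zero] at e'
    exact e'.unique h.symm Gen.zero

theorem exists_isResolvent (τ : ShiftSystem n H) (b : BoundaryKind) (i : Fin (n + 1)) :
    ∃ J D : H →L[ℝ] H, IsResolvent τ b i J D := by
  have hp := τ.pair (some i)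
  -- For Dirichlet, `A` is the generator of `T'`, which carries the condition on `u`. For Neumann,
  -- `A` is the generator of `T`, and the condition falls on `A u` through the domain of `A*`.
  by_cases hi : i = 0 → b = .dirichlet
  · obtain ⟨J, K, hJ⟩ := exists_resolvent hp.symm
    obtain ⟨h₁, h₂, h₃⟩ := resolvent_properties hp.symm hJ
    have hbc : ∀ f, Gen (τ.T' (some i)) (J f) (-(-K) f) := fun f => by
      simpa using (hJ f).1
    refine ⟨J, -K, fun f => (hbc f).neg_of_cancel hp (τ.cancel (some i)), fun f => ?_,
      fun _ => hbc, fun h0 hb => ?_, fun B hB hB' => ?_, h₂, h₃⟩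
    · simpa using (hJ f).2.neg
    · rw [hi h0] at hb
      cases hb
    · exact ⟨(h₁ B hB' hB).1, (h₁ B hB' hB).2.neg_right⟩
  · obtain ⟨J, K, hJ⟩ := exists_resolvent hp
    obtain ⟨h₁, h₂, h₃⟩ := resolvent_properties hp hJ
    have hbc : ∀ f, Gen (τ.T' (some i)) (K f) (-(J f - f)) := fun f => by
      simpa using (hJ f).2
    exact ⟨J, K, fun f => (hJ f).1, fun f => (hbc f).neg_of_cancel hp (τ.cancel (some i)),
      fun h => absurd h hi, fun _ _ => hbc, h₁, h₂, h₃⟩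

theorem commutes_of_commute_all {τ : ShiftSystem n H} {b : BoundaryKind} {i : Fin (n + 1)}
    {J D : H →L[ℝ] H} (h : IsResolvent τ b i J D) {c : Option (Fin (n + 1))} (hc : c ≠ some i) :
    (Commutes J (τ.T c) ∧ Commutes J (τ.T' c)) ∧ (Commutes D (τ.T c) ∧ Commutes D (τ.T' c)) := by
  have h₁ : ∀ s, Commute (τ.T c s) J ∧ Commute (τ.T c s) D := fun s =>
    h.comm _ (fun r x => τ.comm _ _ hc _ _ _) (fun r x => τ.comm' _ _ hc _ _ _)
  have h₂ : ∀ s, Commute (τ.T' c s) J ∧ Commute (τ.T' c s) D := fun s => by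
    refine h.comm _ (fun r x => (τ.comm' _ _ hc.symm _ _ _).symm) (fun r x => ?_)
    refine ext_inner_left ℝ fun y => ?_
    rw [← (τ.pair c).adj, ← (τ.pair (some i)).adj, ← (τ.pair (some i)).adj, ← (τ.pair c).adj,
      τ.comm _ _ hc]
  exact ⟨⟨fun s x => DFunLike.congr_fun (h₁ s).1.symm x,
    fun s x => DFunLike.congr_fun (h₂ s).1.symm x⟩,
    ⟨fun s x => DFunLike.congr_fun (h₁ s).2.symm x,
    fun s x => DFunLike.congr_fun (h₂ s).2.symm x⟩⟩

theorem IsResolvent.commute {τ : ShiftSystem n H} {b : BoundaryKind} {i j : Fin (n + 1)}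
    (hij : i ≠ j) {J D J' D' : H →L[ℝ] H} (h : IsResolvent τ b i J D)
    (h' : IsResolvent τ b j J' D') :
    (Commute J J' ∧ Commute J D') ∧ (Commute D J' ∧ Commute D D') := by
  obtain ⟨⟨e₁, e₂⟩, e₃, e₄⟩ := commutes_of_commute_all h (c := some j) (by simpa using hij.symm)
  exact ⟨h'.comm J e₁ e₂, h'.comm D e₃ e₄⟩

/-- For every `y` there is a function with all spatial derivatives and boundary conditions, obtained
by applying a symmetric injective smoothing operator `P` to `y`. -/
theorem exists_smoothing (τ : ShiftSystem n H) (b : BoundaryKind) :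
    ∃ (P N : H →L[ℝ] H) (G : Fin (n + 1) → H →L[ℝ] H)
      (E : Fin (n + 1) → Fin (n + 1) → H →L[ℝ] H),
      (∀ x y, ⟪P x, y⟫ = ⟪x, P y⟫) ∧ (∀ x y, ⟪N x, y⟫ = ⟪x, N y⟫) ∧ (∀ x, P x = 0 → x = 0) ∧
      Commutes P (τ.T none) ∧ (∀ y, ∑ i, E i i y = N y) ∧
      ∀ y d, Gen (τ.T none) (P y) (-d) →
        InSpace τ b (P y) (fun i => G i y) (fun i j => E i j y) d := by
  choose J D hR using exists_isResolvent τ b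
  have hcomm : ∀ i j, Commute (J i) (J j) := fun i j => by
    by_cases hij : i = j
    · rw [hij]
    · exact ((hR i).commute hij (hR j)).1.1
  -- Products of the commuting resolvents; removing the factor with index `i` leaves one that can be
  -- differentiated in `x_i` by means of `D i`.
  let Pr : Finset (Fin (n + 1)) → H →L[ℝ] H := fun s =>
    s.noncommProd J fun i _ j _ _ => hcomm i j
  have hmul : ∀ (s : Finset (Fin (n + 1))) i, i ∈ s → J i * Pr (s.erase i) = Pr s := fun s i hi =>
    Finset.mul_noncommProd_erase s hi J _
  have hPr : ∀ s (B : H →L[ℝ] H), (∀ i ∈ s, Commute B (J i)) → Commute B (Pr s) := fun s B hB =>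
    Finset.noncommProd_commute s J _ B hB
  have hsymm : ∀ s x y, ⟪Pr s x, y⟫ = ⟪x, Pr s y⟫ := by
    intro s
    induction s using Finset.induction_on with
    | empty =>
      intro x y
      simp only [Pr]
      rfl
    | insert i s hi ih =>
      intro x y
      have e := hmul (insert i s) i (Finset.mem_insert_self i s)
      rw [Finset.erase_insert hi] at e
      have e' : Pr (insert i s) = Pr s * J i := by
        rw [← e]
        exact hPr s (J i) fun j _ => hcomm i j
      conv_lhs => rw [← e]
      rw [e']
      change ⟪J i (Pr s x), y⟫ = ⟪x, Pr s (J i y)⟫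
      rw [(hR i).symm, ih]
  have hinj : ∀ s x, Pr s x = 0 → x = 0 := by
    intro s
    induction s using Finset.induction_on with
    | empty =>
      intro x hx
      simp only [Pr] at hx
      exact hx
    | insert i s hi ih =>
      intro x hx
      have e := hmul (insert i s) i (Finset.mem_insert_self i s)
      rw [Finset.erase_insert hi] at e
      rw [← e] at hx
      exact ih x ((hR i).injective _ hx)
  let P := Pr Finset.univ
  let P₁ : Fin (n + 1) → H →L[ℝ] H := fun i => Pr (Finset.univ.erase i)
  let P₂ : Fin (n + 1) → Fin (n + 1) → H →L[ℝ] H := fun i j => Pr ((Finset.univ.erase i).erase j)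
  have hP₁ : ∀ i y, P y = J i (P₁ i y) := fun i y =>
    DFunLike.congr_fun (hmul _ i (Finset.mem_univ i)).symm y
  have hP₂ : ∀ i j, i ≠ j → ∀ y, P₁ i y = J j (P₂ i j y) := fun i j hij y =>
    DFunLike.congr_fun (hmul _ j (Finset.mem_erase.2 ⟨hij.symm, Finset.mem_univ j⟩)).symm y
  -- On the diagonal `D_i² J_i = J_i - 1`; off it, each of two distinct factors absorbs one
  -- derivative.
  let E : Fin (n + 1) → Fin (n + 1) → H →L[ℝ] H := fun i j =>
    if i = j then P - P₁ i else D j * (D i * P₂ i j)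
  refine ⟨P, ∑ i, (P - P₁ i), fun i => D i * P₁ i, E, hsymm _, fun x y => ?_, hinj _,
    fun s x => ?_, fun y => by simp only [E, if_true, sum_apply], fun y d hd => ⟨fun i => ?_, fun i j => ?_, hd, ?_,
    fun i hi => ?_⟩⟩
  · simp only [sum_apply, sub_apply, sum_inner, inner_sum, inner_sub_left, inner_sub_right]
    exact Finset.sum_congr rfl fun i _ => by rw [hsymm, hsymm]
  · refine DFunLike.congr_fun (hPr Finset.univ (τ.T none s) fun i _ => ?_).symm x
    exact ContinuousLinearMap.ext fun x =>
      ((commutes_of_commute_all (hR i) (c := none) (by simp)).1.1 s x).symm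
  · rw [hP₁ i]
    exact (hR i).grad _
  · by_cases hij : i = j
    · subst hij
      simp only [E, if_true, sub_apply]
      rw [hP₁ i]
      exact (hR i).hess _
    · simp only [E, if_neg hij]
      have e : (D i * P₁ i) y = J j (D i (P₂ i j y)) := by
        change D i (P₁ i y) = _
        rw [hP₂ i j hij]
        exact DFunLike.congr_fun ((hR i).commute hij (hR j)).2.1 _
      rw [e]
      exact (hR j).grad _
  · cases b
    · change Gen _ (P y) _
      rw [hP₁ 0]
      exact (hR 0).bc (fun _ => rfl) _
    · simp only [E, if_true, sub_apply]
      rw [hP₁ 0]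
      exact (hR 0).bc_neumann rfl rfl _
  · rw [hP₁ i]
    exact (hR i).bc (fun h => absurd h hi) _

end Resolvents

/-! ### Density of the range of the heat operator -/

section HeatEquation

variable {H : Type*} [NormedAddCommGroup H] [InnerProductSpace ℝ H] [CompleteSpace H] {n : ℕ}

/-- The range of the heat operator is dense. -/
theorem eq_zero_of_orthogonal_heat (τ : ShiftSystem n H) (b : BoundaryKind) {lam : ℝ}
    (hlam : 0 < lam) {x : H}
    (hx : ∀ u g h d, InSpace τ b u g h d → ⟪x, -d + ∑ i, h i i - lam • u⟫ = 0) : x = 0 := by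
  obtain ⟨P, N, G, E, hP, hN, hinj, hPt, hEN, hX⟩ := exists_smoothing τ b
  -- Testing with `u = P p` and moving `P` and `N` onto `x` shows that `w = P x` solves `w_t + Δw -
  -- λw = 0` with zero final data, where `Δw = N x`.
  have hg : Gen (τ.T' none) (P x) (-(N x - lam • P x)) := by
    refine Gen.of_adjoint (τ.pair none).symm fun p d hpd => ?_
    have e := hx _ _ _ _ (hX p (-P d) (by simpa using hpd.map (τ.pair none) P hPt))
    rw [hEN, neg_neg, inner_sub_right, inner_add_right, real_inner_smul_right, ← hP, ← hN,
      ← hP] at e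
    rw [real_inner_comm, inner_neg_left, inner_sub_left, real_inner_smul_left]
    linarith [real_inner_comm d (P x)]
  have hg' := hg.neg_of_cancel (τ.pair none) (τ.cancel none)
  have hu := hX x (-(N x - lam • P x)) (by rwa [neg_neg])
  -- Zero final data makes the time derivative skew on `w`, so `⟪w, Δw - λw⟫ = 0`, while `⟪w, Δw⟫ ≤
  -- 0`.
  have e₁ := hg'.adjoint (τ.pair none) hg
  rw [inner_neg_left, real_inner_comm (P x)] at e₁
  have e₂ : ⟪P x, N x⟫ ≤ 0 := by
    rw [← hEN, inner_sum]
    refine Finset.sum_nonpos fun i _ => ?_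
    have := hu.inner_hess_self (k := i) (commutes_id _) (commutes_id _)
    simp only [ContinuousLinearMap.id_apply] at this
    rw [this]
    exact neg_nonpos.2 real_inner_self_nonneg
  have e₃ : ⟪P x, N x - lam • P x⟫ = 0 := by linarith [real_inner_comm (P x) (N x - lam • P x)]
  rw [inner_sub_right, real_inner_smul_right] at e₃
  have e₄ := real_inner_self_nonneg (x := P x)
  refine hinj x (inner_self_eq_zero.1 (le_antisymm ?_ e₄))
  nlinarith

end HeatEquation

/-! ### Method of continuity -/

section Continuity

variable {X H : Type*} [NormedAddCommGroup X] [NormedSpace ℝ X] [CompleteSpace X]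
  [NormedAddCommGroup H] [NormedSpace ℝ H] [CompleteSpace H]

/-- Write `M = (1 - B) L` with `B = (L - M) L⁻¹`; since `‖B‖ < 1`, the first factor is invertible by
the Neumann series. -/
theorem surjective_of_near {L M : X →L[ℝ] H} {K : ℝ} (hK : 0 ≤ K) (hL : ∀ x, ‖x‖ ≤ K * ‖L x‖)
    (hs : Function.Surjective L) (hM : K * ‖M - L‖ < 1) : Function.Surjective M := by
  have hi : Function.Injective L := by
    rw [injective_iff_map_eq_zero]
    intro x hx
    have := hL x
    rw [hx, norm_zero, mul_zero] at this
    exact norm_le_zero_iff.1 this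
  let e := ContinuousLinearEquiv.ofBijective L (LinearMap.ker_eq_bot.2 hi)
    (LinearMap.range_eq_top.2 hs)
  have he : ∀ y, L (e.symm y) = y := fun y => e.apply_symm_apply y
  let B : H →L[ℝ] H := (L - M) ∘L (e.symm : H →L[ℝ] X)
  have hB : ‖B‖ < 1 := by
    refine lt_of_le_of_lt (ContinuousLinearMap.opNorm_le_bound _ (by positivity) fun y => ?_) hM
    calc ‖(L - M) (e.symm y)‖ ≤ ‖L - M‖ * ‖e.symm y‖ := (L - M).le_opNorm _
      _ ≤ ‖L - M‖ * (K * ‖y‖) := by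
          gcongr
          have := hL (e.symm y)
          rwa [he] at this
      _ = K * ‖M - L‖ * ‖y‖ := by rw [norm_sub_rev]; ring
  obtain ⟨w, hw⟩ := isUnit_one_sub_of_norm_lt_one hB
  intro f
  refine ⟨e.symm (w⁻¹.val f), ?_⟩
  have h₁ : (1 - B) (w⁻¹.val f) = f := by
    rw [← hw]
    exact DFunLike.congr_fun w.mul_inv f
  have h₂ : (1 - B) (w⁻¹.val f) = w⁻¹.val f - (L - M) (e.symm (w⁻¹.val f)) := rfl
  rw [h₂, sub_apply, he, sub_sub_cancel] at h₁
  exact h₁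

/-- The method of continuity. -/
theorem surjective_of_continuity {L M : X →L[ℝ] H} {K : ℝ} (hK : 0 ≤ K)
    (h : ∀ s : ℝ, 0 ≤ s → s ≤ 1 → ∀ x, ‖x‖ ≤ K * ‖((1 - s) • L + s • M) x‖)
    (hs : Function.Surjective L) : Function.Surjective M := by
  -- The number of steps is chosen so that each moves the operator by less than `1 / K`.
  obtain ⟨m, hm⟩ := exists_nat_gt (K * ‖M - L‖)
  have hm0 : (0 : ℝ) < m := lt_of_le_of_lt (by positivity) hm
  have key : ∀ j : ℕ, j ≤ m → Function.Surjective ((1 - (j : ℝ) / m) • L + ((j : ℝ) / m) • M) := by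
    intro j
    induction j with
    | zero => intro _; simpa using hs
    | succ j ih =>
      intro hj
      have hj' : (j : ℝ) + 1 ≤ m := by exact_mod_cast hj
      refine surjective_of_near hK (h _ (by positivity) ?_) (ih (by omega)) ?_
      · rw [div_le_one hm0]
        linarith
      · have e : ((1 - ((j + 1 : ℕ) : ℝ) / m) • L + (((j + 1 : ℕ) : ℝ) / m) • M) -
            ((1 - (j : ℝ) / m) • L + ((j : ℝ) / m) • M) = (m : ℝ)⁻¹ • (M - L) := by
          push_cast
          module
        rw [e, norm_smul, Real.norm_of_nonneg (by positivity), mul_left_comm, inv_mul_eq_div,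
          div_lt_one hm0]
        exact hm
  have := key m le_rfl
  rwa [div_self hm0.ne', sub_self, zero_smul, zero_add, one_smul] at this

end Continuity

/-! ### The solution space as a closed subspace -/

section SolutionSpace

variable {H : Type*} [NormedAddCommGroup H] [InnerProductSpace ℝ H] [CompleteSpace H] {n : ℕ}

/-- Tuples `(u, Du, D²u, u_t)`. -/
abbrev Jet (n : ℕ) (H : Type*) : Type _ :=
  H × (Fin (n + 1) → H) × (Fin (n + 1) → Fin (n + 1) → H) × H

/-- The solution space as a subspace of the space of tuples `(u, Du, D²u, u_t)`. -/
def solutionSpace (τ : ShiftSystem n H) (b : BoundaryKind) : Submodule ℝ (Jet n H) where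
  carrier := {x | InSpace τ b x.1 x.2.1 x.2.2.1 x.2.2.2}
  zero_mem' := by
    refine ⟨fun i => Gen.zero, fun i j => Gen.zero, ?_, ?_, fun i hi => ?_⟩
    · simpa using Gen.zero
    · cases b <;> simpa using Gen.zero
    · simpa using Gen.zero
  add_mem' {x y} hx hy := by
    refine ⟨fun i => (hx.grad i).add (τ.pair _) (hy.grad i),
      fun i j => (hx.hess i j).add (τ.pair _) (hy.hess i j), ?_, ?_, fun i hi => ?_⟩
    · convert! hx.time.add (τ.pair _) hy.time using 1
      exact neg_add _ _
    · have h₁ := hx.bc_first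
      have h₂ := hy.bc_first
      cases b
      · convert! Gen.add (τ.pair _).symm h₁ h₂ using 1
        exact neg_add _ _
      · convert! Gen.add (τ.pair _).symm h₁ h₂ using 1
        exact neg_add _ _
    · convert! (hx.bc i hi).add (τ.pair _).symm (hy.bc i hi) using 1
      exact neg_add _ _
  smul_mem' c x hx := by
    refine ⟨fun i => (hx.grad i).smul c, fun i j => (hx.hess i j).smul c, ?_, ?_, fun i hi => ?_⟩
    · convert! hx.time.smul c using 1
      simp
    · have h₁ := hx.bc_first
      cases b
      · convert! Gen.smul c h₁ using 1
        simp
      · convert! Gen.smul c h₁ using 1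
        simp
    · convert! (hx.bc i hi).smul c using 1
      simp

theorem isClosed_solutionSpace (τ : ShiftSystem n H) (b : BoundaryKind) :
    IsClosed (solutionSpace τ b : Set (Jet n H)) := by
  have hc : ∀ {V W : ℝ → H →L[ℝ] H}, ShiftPair V W → ∀ {p q : Jet n H → H}, Continuous p →
      Continuous q → IsClosed {x | Gen V (p x) (q x)} := fun h _ _ hp hq =>
    (isClosed_gen h).preimage (hp.prodMk hq)
  have e : (solutionSpace τ b : Set (Jet n H)) =
      (⋂ i, {x | Gen (τ.T (some i)) x.1 (x.2.1 i)}) ∩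
      (⋂ i, ⋂ j, {x | Gen (τ.T (some j)) (x.2.1 i) (x.2.2.1 i j)}) ∩
      {x | Gen (τ.T none) x.1 (-x.2.2.2)} ∩
      {x | match b with
        | .dirichlet => Gen (τ.T' (some 0)) x.1 (-x.2.1 0)
        | .neumann => Gen (τ.T' (some 0)) (x.2.1 0) (-x.2.2.1 0 0)} ∩
      (⋂ i, ⋂ (_ : i ≠ 0), {x | Gen (τ.T' (some i)) x.1 (-x.2.1 i)}) := by
    ext x
    simp only [Set.mem_inter_iff, Set.mem_iInter, Set.mem_ofPred_eq]
    exact ⟨fun h => ⟨⟨⟨⟨h.grad, h.hess⟩, h.time⟩, h.bc_first⟩, h.bc⟩,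
      fun h => ⟨h.1.1.1.1, h.1.1.1.2, h.1.1.2, h.1.2, h.2⟩⟩
  rw [e]
  refine ((((isClosed_iInter fun i => hc (τ.pair _) (by fun_prop) (by fun_prop)).inter
    (isClosed_iInter fun i => isClosed_iInter fun j => hc (τ.pair _) (by fun_prop)
      (by fun_prop))).inter (hc (τ.pair _) (by fun_prop) (by fun_prop))).inter ?_).inter
    (isClosed_iInter fun i => isClosed_iInter fun _ => hc (τ.pair _).symm (by fun_prop)
      (by fun_prop))
  cases b
  · exact hc (τ.pair _).symm (by fun_prop) (by fun_prop)
  · exact hc (τ.pair _).symm (by fun_prop) (by fun_prop)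

/-- The operator `-u_t + A_{ij} D_{ij} u - λ u` on tuples `(u, Du, D²u, u_t)`. -/
noncomputable def jetOp (A : Fin (n + 1) → Fin (n + 1) → H →L[ℝ] H) (lam : ℝ) :
    Jet n H →L[ℝ] H :=
  { toFun := fun x => -x.2.2.2 + ∑ i, ∑ j, A i j (x.2.2.1 i j) - lam • x.1
    map_add' := fun x y => by
      simp only [Prod.fst_add, Prod.snd_add, Pi.add_apply, map_add, Finset.sum_add_distrib]
      module
    map_smul' := fun c x => by
      simp only [Prod.smul_fst, Prod.smul_snd, Pi.smul_apply, map_smul, ← Finset.smul_sum,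
        RingHom.id_apply]
      module
    cont := by fun_prop }

theorem jetOp_apply (A : Fin (n + 1) → Fin (n + 1) → H →L[ℝ] H) (lam : ℝ) (x : Jet n H) :
    jetOp A lam x = -x.2.2.2 + ∑ i, ∑ j, A i j (x.2.2.1 i j) - lam • x.1 := rfl

/-- The coefficients of the Laplacian. -/
def laplaceOp (n : ℕ) (H : Type*) [NormedAddCommGroup H] [InnerProductSpace ℝ H]
    (i j : Fin (n + 1)) : H →L[ℝ] H :=
  if i = j then ContinuousLinearMap.id ℝ H else 0

/-- The estimate bounds the operator from below on a complete space, so its range is closed; its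
orthogonal complement is trivial by `eq_zero_of_orthogonal_heat`. -/
theorem surjective_jetOp_laplace (τ : ShiftSystem n H) (b : BoundaryKind) {lam : ℝ}
    (hlam : 0 < lam) {K : ℝ} (hK : 0 ≤ K)
    (h : ∀ x ∈ solutionSpace τ b, ‖x‖ ≤ K * ‖jetOp (laplaceOp n H) lam x‖) :
    Function.Surjective (jetOp (laplaceOp n H) lam ∘L (solutionSpace τ b).subtypeL) := by
  set X := solutionSpace τ b
  set L := jetOp (laplaceOp n H) lam ∘L X.subtypeL
  have : CompleteSpace X := (isClosed_solutionSpace τ b).completeSpace_coe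
  have hcl : IsClosed (Set.range L) := by
    have ha : AntilipschitzWith ⟨K, hK⟩ L :=
      AddMonoidHomClass.antilipschitz_of_bound L fun x => h x.1 x.2
    exact ha.isClosed_range L.uniformContinuous
  have htop : L.range = ⊤ := by
    rw [← IsClosed.submodule_topologicalClosure_eq (s := L.range) hcl,
      Submodule.topologicalClosure_eq_top_iff, Submodule.eq_bot_iff]
    intro y hy
    refine eq_zero_of_orthogonal_heat τ b hlam fun u g k d hu => ?_
    have e := Submodule.inner_left_of_mem_orthogonal (LinearMap.mem_range_self L.toLinearMap
      (⟨(u, g, k, d), hu⟩ : X)) hy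
    have e₁ : L ⟨(u, g, k, d), hu⟩ = -d + ∑ i, k i i - lam • u := by
      change jetOp (laplaceOp n H) lam (u, g, k, d) = _
      rw [jetOp_apply]
      congr 2
      refine Finset.sum_congr rfl fun i _ => ?_
      rw [Finset.sum_eq_single i]
      · simp [laplaceOp]
      · intro j _ hj
        simp [laplaceOp, hj.symm]
      · simp
    rw [← e₁]
    exact e
  exact LinearMap.range_eq_top.1 htop

theorem exists_jetOp_eq (τ : ShiftSystem n H) (b : BoundaryKind) {lam : ℝ} (hlam : 0 < lam)
    (A : Fin (n + 1) → Fin (n + 1) → H →L[ℝ] H) {K : ℝ} (hK : 0 ≤ K)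
    (h : ∀ r : ℝ, 0 ≤ r → r ≤ 1 → ∀ x ∈ solutionSpace τ b,
      ‖x‖ ≤ K * ‖(1 - r) • jetOp (laplaceOp n H) lam x + r • jetOp A lam x‖) (f : H) :
    ∃ x ∈ solutionSpace τ b, jetOp A lam x = f := by
  have : CompleteSpace (solutionSpace τ b) := (isClosed_solutionSpace τ b).completeSpace_coe
  have hheat := surjective_jetOp_laplace τ b hlam hK fun x hx => by
    simpa using h 0 le_rfl zero_le_one x hx
  obtain ⟨x, hx⟩ := surjective_of_continuity
    (M := jetOp A lam ∘L (solutionSpace τ b).subtypeL) hK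
    (fun r hr0 hr1 x => h r hr0 hr1 x.1 x.2) hheat f
  exact ⟨x.1, x.2, hx⟩

end SolutionSpace

/-! ### Existence and uniqueness -/

section Existence

variable {n : ℕ} {T : WithTop ℝ} {k : ℕ} {δ : ℝ}
  {a : Fin (n + 1) → Fin (n + 1) → ℝ → ℝ → ℝ}

/-- The coefficients joining those of the Laplacian to `a`. -/
def interpolateCoeff (a : Fin (n + 1) → Fin (n + 1) → ℝ → ℝ → ℝ) (r : ℝ) (i j : Fin (n + 1))
    (t s : ℝ) : ℝ :=
  (1 - r) * (if i = j then 1 else 0) + r * a i j t s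

/-- The class is convex as long as the kind of dependence of a^{dd} is fixed, and it contains the
identity because `δ < 1`. The same `δ` gives an estimate uniform along the segment. -/
theorem AdmissibleCoeff.interpolate (hδ0 : 0 < δ) (hδ1 : δ < 1) (ha : AdmissibleCoeff δ a)
    {r : ℝ} (hr0 : 0 ≤ r) (hr1 : r ≤ 1) : AdmissibleCoeff δ (interpolateCoeff a r) where
  meas i j := by
    unfold interpolateCoeff
    exact aemeasurable_const.add ((ha.meas i j).const_mul r)
  elliptic t s ξ := by
    have h₁ := ha.elliptic t s ξ
    have h₂ : 0 ≤ ∑ i, ξ i ^ 2 := Finset.sum_nonneg fun _ _ => sq_nonneg _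
    have e : ∑ i, ∑ j, interpolateCoeff a r i j t s * ξ i * ξ j =
        (1 - r) * ∑ i, ξ i ^ 2 + r * ∑ i, ∑ j, a i j t s * ξ i * ξ j := by
      simp only [interpolateCoeff, add_mul, Finset.sum_add_distrib, Finset.mul_sum]
      congr 1
      · refine Finset.sum_congr rfl fun i _ => ?_
        rw [Finset.sum_eq_single i]
        · simp only [if_true]
          ring
        · intro j _ hj
          simp [hj.symm]
        · simp
      · simp only [mul_assoc]
    rw [e]
    nlinarith [mul_le_mul_of_nonneg_left h₁ hr0, mul_nonneg (sub_nonneg.2 hr1)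
      (mul_nonneg (sub_nonneg.2 hδ1.le) h₂)]
  bounded i j t s := by
    have h₁ := ha.bounded i j t s
    have hδi : 1 ≤ δ⁻¹ := (one_le_inv₀ hδ0).2 hδ1.le
    have h₂ : |if i = j then (1 : ℝ) else 0| ≤ δ⁻¹ := by
      split_ifs
      · simpa using hδi
      · simpa using zero_le_one.trans hδi
    calc |interpolateCoeff a r i j t s| ≤
        |(1 - r) * (if i = j then (1 : ℝ) else 0)| + |r * a i j t s| := abs_add_le _ _
      _ ≤ (1 - r) * δ⁻¹ + r * δ⁻¹ := by
          rw [abs_mul, abs_mul, abs_of_nonneg hr0, abs_of_nonneg (sub_nonneg.2 hr1)]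
          gcongr
      _ = δ⁻¹ := by ring
  last := by
    simp only [interpolateCoeff, if_true]
    refine ha.last.imp ?_ ?_
    · rintro ⟨α, hm, hα⟩
      exact ⟨fun t => (1 - r) * 1 + r * α t, aemeasurable_const.add (hm.const_mul r),
        fun t s => by rw [hα]⟩
    · rintro ⟨α, hm, hα⟩
      exact ⟨fun t => (1 - r) * 1 + r * α t, aemeasurable_const.add (hm.const_mul r),
        fun t s => by rw [hα]⟩

theorem coeffOp_interpolate (ha : AdmissibleCoeff δ a) {r : ℝ}
    (hr : AdmissibleCoeff δ (interpolateCoeff a r)) (S : Set (SpaceTime n)) (i j : Fin (n + 1))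
    (x : L2 S) :
    coeffOp hr S i j x = (1 - r) • laplaceOp n (L2 S) i j x + r • coeffOp ha S i j x := by
  have h₀ : ∀ᵐ z ∂(volume.restrict S), laplaceOp n (L2 S) i j x z =
      (if i = j then (1 : ℝ) else 0) * x z := by
    rw [laplaceOp]
    split_ifs
    · exact ae_of_all _ fun z => (one_mul _).symm
    · filter_upwards [Lp.coeFn_zero ℝ 2 (volume.restrict S)] with z hz
      rw [zero_mul]
      exact hz
  refine Lp.ext ?_
  filter_upwards [mulL2_coe (hr.memLp S i j) x, mulL2_coe (ha.memLp S i j) x, h₀,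
    Lp.coeFn_add ((1 - r) • laplaceOp n (L2 S) i j x) (r • coeffOp ha S i j x),
    Lp.coeFn_smul (1 - r) (laplaceOp n (L2 S) i j x), Lp.coeFn_smul r (coeffOp ha S i j x)]
    with z h₁ h₂ h₃ h₄ h₅ h₆
  rw [h₄, Pi.add_apply, h₅, h₆, Pi.smul_apply, Pi.smul_apply, h₃, coeffOp, h₁, coeffOp, h₂]
  simp only [coeffFun, interpolateCoeff, smul_eq_mul]
  ring

theorem jetOp_interpolate (ha : AdmissibleCoeff δ a) {r : ℝ}
    (hr : AdmissibleCoeff δ (interpolateCoeff a r)) (S : Set (SpaceTime n)) (lam : ℝ)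
    (x : Jet n (L2 S)) :
    jetOp (coeffOp hr S) lam x =
      (1 - r) • jetOp (laplaceOp n (L2 S)) lam x + r • jetOp (coeffOp ha S) lam x := by
  have e : ∑ i, ∑ j, coeffOp hr S i j (x.2.2.1 i j) =
      (1 - r) • ∑ i, ∑ j, laplaceOp n (L2 S) i j (x.2.2.1 i j) +
        r • ∑ i, ∑ j, coeffOp ha S i j (x.2.2.1 i j) := by
    simp only [coeffOp_interpolate ha hr, Finset.sum_add_distrib, ← Finset.smul_sum]
  rw [jetOp_apply, jetOp_apply, jetOp_apply, e]
  module

theorem norm_jet_le (hδ0 : 0 < δ) (hδ1 : δ < 1) (ha : AdmissibleCoeff δ a) (b : BoundaryKind)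
    {lam : ℝ} (hlam : 0 < lam) (x : Jet n (L2 (wedgeCylinder n T k)))
    (hx : x ∈ solutionSpace (wedgeShifts n T k) b) :
    ‖x‖ ≤ ((1 + lam⁻¹ + (√lam)⁻¹) * aprioriConst n δ) * ‖jetOp (coeffOp ha _) lam x‖ := by
  obtain ⟨e₁, e₂, e₃, e₄⟩ := InSpace.apriori hδ0 hδ1 ha hx hlam.le
    (jetOp_apply (coeffOp ha _) lam x).symm
  set M := aprioriConst n δ * ‖jetOp (coeffOp ha _) lam x‖ with hM
  have hM0 : 0 ≤ M := (norm_nonneg _).trans e₂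
  have hs : 0 < √lam := Real.sqrt_pos.2 hlam
  rw [mul_assoc, ← hM]
  have h₀ : M ≤ (1 + lam⁻¹ + (√lam)⁻¹) * M := by
    refine le_mul_of_one_le_left hM0 ?_
    have : 0 ≤ lam⁻¹ := by positivity
    have : 0 ≤ (√lam)⁻¹ := by positivity
    linarith
  have h₁ : ‖x.1‖ ≤ (1 + lam⁻¹ + (√lam)⁻¹) * M := by
    have : ‖x.1‖ ≤ lam⁻¹ * M := by
      rw [inv_mul_eq_div, le_div_iff₀ hlam, mul_comm]
      exact e₃
    refine this.trans ?_
    gcongr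
    have : 0 ≤ (√lam)⁻¹ := by positivity
    linarith
  have h₂ : ∀ i, ‖x.2.1 i‖ ≤ (1 + lam⁻¹ + (√lam)⁻¹) * M := fun i => by
    have : ‖x.2.1 i‖ ≤ (√lam)⁻¹ * M := by
      rw [inv_mul_eq_div, le_div_iff₀ hs, mul_comm]
      exact e₄ i
    refine this.trans ?_
    gcongr
    have : 0 ≤ lam⁻¹ := by positivity
    linarith
  have hR : 0 ≤ (1 + lam⁻¹ + (√lam)⁻¹) * M := hM0.trans h₀
  refine norm_prod_le_iff.2 ⟨h₁, norm_prod_le_iff.2 ⟨(pi_norm_le_iff_of_nonneg hR).2 h₂,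
    norm_prod_le_iff.2 ⟨(pi_norm_le_iff_of_nonneg hR).2 fun i =>
      (pi_norm_le_iff_of_nonneg hR).2 fun j => (e₁ i j).trans h₀, e₂.trans h₀⟩⟩⟩

theorem exists_solution (hδ0 : 0 < δ) (hδ1 : δ < 1) (ha : AdmissibleCoeff δ a) (b : BoundaryKind)
    {lam : ℝ} (hlam : 0 < lam) (f : L2 (wedgeCylinder n T k)) :
    ∃ x ∈ solutionSpace (wedgeShifts n T k) b, jetOp (coeffOp ha _) lam x = f := by
  have hK : 0 ≤ (1 + lam⁻¹ + (√lam)⁻¹) * aprioriConst n δ :=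
    mul_nonneg (by positivity) (aprioriConst_pos n hδ0).le
  refine exists_jetOp_eq (wedgeShifts n T k) b hlam (coeffOp ha _) hK (fun r hr0 hr1 x hx => ?_) f
  have hr := ha.interpolate hδ0 hδ1 hr0 hr1
  refine (norm_jet_le hδ0 hδ1 hr b hlam x hx).trans (le_of_eq ?_)
  rw [← jetOp_interpolate ha hr]

theorem W12.ext_fields {u v : W12 n T k} (h₁ : u.val = v.val) (h₂ : u.grad = v.grad)
    (h₃ : u.hess = v.hess) (h₄ : u.dt = v.dt) : u = v := by
  cases u
  cases v
  cases h₁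
  cases h₂
  cases h₃
  cases h₄
  rfl

theorem W12.existsUnique_solution (hδ0 : 0 < δ) (hδ1 : δ < 1) (ha : AdmissibleCoeff δ a)
    (b : BoundaryKind) {lam : ℝ} (hlam : 0 < lam) (f : L2 (wedgeCylinder n T k)) :
    ∃! u : W12 n T k, u.BoundaryCondition b ∧ u.Solves a lam f := by
  obtain ⟨x, hx, hf⟩ := exists_solution hδ0 hδ1 ha b hlam f
  obtain ⟨u, h₁, h₂, h₃, h₄, hu⟩ := InSpace.exists_W12 hx
  rw [jetOp_apply, ← h₁, ← h₃, ← h₄] at hf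
  have hsol := (u.solves_iff ha lam f).2 hf
  refine ⟨u, ⟨hu, hsol⟩, fun v hv => ?_⟩
  have hf' := (v.solves_iff ha lam f).1 hv.2
  have hmem : ∀ w : W12 n T k, w.BoundaryCondition b →
      ((w.val, w.grad, w.hess, w.dt) : Jet n _) ∈ solutionSpace (wedgeShifts n T k) b :=
    fun w hw => w.inSpace hw
  -- The difference of two solutions has zero right-hand side, and the estimate annihilates the
  -- function together with its recorded derivatives.
  have e := norm_jet_le hδ0 hδ1 ha b hlam _ (sub_mem (hmem v hv.1) (hmem u hu))
  rw [map_sub, jetOp_apply, jetOp_apply, hf, hf', sub_self, norm_zero, mul_zero,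
    norm_le_zero_iff, sub_eq_zero] at e
  simp only [Prod.mk.injEq] at e
  exact W12.ext_fields e.1 e.2.1 e.2.2.1 e.2.2.2

end Existence

end ParabolicWedge

theorem mainTheorem5 (n : ℕ) (δ : ℝ) (hδ0 : 0 < δ) (hδ1 : δ < 1) :
    ∃ N : ℝ, 0 < N ∧
      ∀ (T : WithTop ℝ) (k : ℕ), 1 ≤ k → k ≤ n + 1 →
      ∀ a : Fin (n + 1) → Fin (n + 1) → ℝ → ℝ → ℝ, ParabolicWedge.AdmissibleCoeff δ a →
      ∀ b : ParabolicWedge.BoundaryKind,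
        (∀ lam : ℝ, 0 ≤ lam →
          ∀ (f : ParabolicWedge.L2 (ParabolicWedge.wedgeCylinder n T k))
            (u : ParabolicWedge.W12 n T k),
            u.BoundaryCondition b → u.Solves a lam f →
            lam * ‖u.val‖ + √lam * u.gradNorm + u.hessNorm + ‖u.dt‖ ≤ N * ‖f‖) ∧
        (∀ lam : ℝ, 0 < lam →
          ∀ f : ParabolicWedge.L2 (ParabolicWedge.wedgeCylinder n T k),
            ∃! u : ParabolicWedge.W12 n T k,
              u.BoundaryCondition b ∧ u.Solves a lam f) := by
  refine ⟨(2 + ((n + 1 : ℕ) : ℝ) + ((n + 1 : ℕ) : ℝ) ^ 2) * ParabolicWedge.aprioriConst n δ,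
    mul_pos (by positivity) (ParabolicWedge.aprioriConst_pos n hδ0), ?_⟩
  intro T k _ _ a ha b
  exact ⟨fun lam hlam f u hu hf => ParabolicWedge.W12.estimate hδ0 hδ1 ha hlam hu hf,
    fun lam hlam f => ParabolicWedge.W12.existsUnique_solution hδ0 hδ1 ha b hlam f⟩
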